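/- Let $\alpha\in(1,3)$, $a_\alpha=-\cos(\alpha\pi/2)>0$ and, for $\xi\in\mathbb R$, put $h_\alpha(\xi)=|\xi|/\sqrt{1+a_\alpha|\xi|^\alpha}$. Let $\mathcal F$ be the Fourier transform in the space variable, $\mathcal F w(\xi)=\int e^{-ix\xi}w(x)\,dx$; convolutions in $x$ are defined by multiplication of Fourier transforms: if $\mathcal F S$ and $\mathcal F T$ are functions whose product is a tempered distribution, then $S*_xT=\mathcal F^{-1}(\mathcal FS\cdot\mathcal FT)$. Let $$Pu=\partial_t^2u-L^\alpha_x\partial_x^2u,\qquad L^\alpha_xw=\mathcal F^{-1}_{\xi\to x}\Big(\frac1{1+a_\alpha|\xi|^\alpha}\Big)*_xw ,$$ for $u\in L^1_{\rm loc}(\mathbb R_t,H^s(\mathbb R_x))\cap\mathcal S'(\mathbb R^2)$, where $L^\alpha_x\partial_x^2$ acts on $u(t)\in H^s(\mathbb R)$ for each $t$. (The equation $Pu=f$ includes the claim that $t\mapsto L^\alpha_x\partial_x^2u(t)$ defines a tempered distribution on $\mathbb R^2$.) **Theorem.** Let $s\in\mathbb R$, $u_0\in H^s(\mathbb R)$ and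 $v_0\in H^{s-1+\alpha/2}(\mathbb R)$. Then the generalized Cauchy problem $$Pu=u_0\otimes\delta'+v_0\otimes\delta\quad\text{in }\mathcal S'(\mathbb R^2)$$ (first tensor factor in $x$, second in $t$) has exactly one solution $u\in L^1_{\rm loc}(\mathbb R,H^s(\mathbb R))\cap\mathcal S'(\mathbb R^2)$ with $\operatorname{supp}u\subseteq\{(x,t):t\ge0\}$. This solution lies in $C^\infty((0,\infty);\mathcal S'(\mathbb R))\cap C((0,\infty);H^s(\mathbb R))$, where smoothness into $\mathcal S'(\mathbb R)$ means that $t\mapsto\langle u(t),\varphi\rangle$ is smooth for every $\varphi\in\mathcal S(\mathbb R)$, and it is given by $$u(t)=u_0*_xE_0(t)+v_0*_xE_1(t),$$ $$E_0(t)=\mathcal F^{-1}_{\xi\to x}\big[\cos(h_\alpha(\xi)t)\,H(t)\big],\qquad E_1(t)=\mathcal F^{-1}_{\xi\to x}\Big[\frac{\sin(h_\alpha(\xi)t)}{h_\alpha(\xi)}\,H(t)\Big],$$ where $H$ is the Heaviside function ($H(t)=1$ for $t\ge0$, $H(t)=0$ for $t<0$). -/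

import Mathlib

open MeasureTheory FourierTransform TemperedDistribution
open scoped SchwartzMap ENNReal ContDiff LineDeriv

noncomputable section

namespace FractionalEringen

/-! Points of space-time are pairs `(x, t) : ℝ × ℝ`, with `x` the space and `t` the time variable.
All distributions are complex valued. -/

/-! ### Slices, and the tensor products with `δ` and `δ'` -/

/-- The slice `Φ ↦ Φ(·, t)` of Schwartz functions at time `t`. -/
def slice (t : ℝ) : 𝓢(ℝ × ℝ, ℂ) →L[ℂ] 𝓢(ℝ, ℂ) :=
  SchwartzMap.compCLMOfAntilipschitz (K := 1) ℂ (g := fun x : ℝ => (x, t))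
    (by
      have h := ((ContinuousLinearMap.inl ℝ ℝ ℝ).hasTemperateGrowth).add
        (Function.HasTemperateGrowth.const ((0, t) : ℝ × ℝ))
      convert h using 1
      ext x <;> simp)
    (AntilipschitzWith.of_le_mul_dist fun x y => by simp [Prod.dist_eq])

@[simp]
theorem slice_apply (t : ℝ) (Φ : 𝓢(ℝ × ℝ, ℂ)) (x : ℝ) : slice t Φ x = Φ (x, t) := rfl

/-- The derivative `∂_t Φ` of a Schwartz function on space-time, as a continuous linear map. -/
def dtSchwartz : 𝓢(ℝ × ℝ, ℂ) →L[ℂ] 𝓢(ℝ × ℝ, ℂ) :=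
  LineDeriv.lineDerivOpCLM ℂ 𝓢(ℝ × ℝ, ℂ) ((0, 1) : ℝ × ℝ)

/-- The tensor product `w ⊗ δ`, that is `⟨w ⊗ δ, Φ⟩ = ⟨w, Φ(·, 0)⟩`. -/
def tensorDelta (w : 𝓢'(ℝ, ℂ)) : 𝓢'(ℝ × ℝ, ℂ) :=
  PointwiseConvergenceCLM.precomp ℂ (slice 0) w

@[simp]
theorem tensorDelta_apply (w : 𝓢'(ℝ, ℂ)) (Φ : 𝓢(ℝ × ℝ, ℂ)) :
    tensorDelta w Φ = w (slice 0 Φ) := rfl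

/-- The tensor product `w ⊗ δ'`, that is `⟨w ⊗ δ', Φ⟩ = -⟨w, ∂_t Φ(·, 0)⟩`. -/
def tensorDeltaDeriv (w : 𝓢'(ℝ, ℂ)) : 𝓢'(ℝ × ℝ, ℂ) :=
  PointwiseConvergenceCLM.precomp ℂ (-(slice 0 ∘L dtSchwartz)) w

@[simp]
theorem tensorDeltaDeriv_apply (w : 𝓢'(ℝ, ℂ)) (Φ : 𝓢(ℝ × ℝ, ℂ)) :
    tensorDeltaDeriv w Φ = -w (slice 0 (∂_{((0, 1) : ℝ × ℝ)} Φ)) := by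
  change w (-(slice 0 (∂_{((0, 1) : ℝ × ℝ)} Φ))) = _
  rw [map_neg]

/-! ### Functions as tempered distributions, and convolution through the Fourier transform -/

/-- The tempered distribution `T` is (given by integration against) the function `f`. -/
def IsFunction (T : 𝓢'(ℝ, ℂ)) (f : ℝ → ℂ) : Prop :=
  ∀ φ : 𝓢(ℝ, ℂ), Integrable (fun ξ => φ ξ * f ξ) ∧ T φ = ∫ ξ, φ ξ * f ξ

open Classical in
/-- The tempered distribution given by an essentially bounded measurable function `f`
(and `0` for all other `f`). -/
def ofBounded (f : ℝ → ℂ) : 𝓢'(ℝ, ℂ) :=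
  if h : MemLp f ∞ (volume : Measure ℝ) then
    ((h.toLp f : Lp ℂ ∞ (volume : Measure ℝ)) : 𝓢'(ℝ, ℂ))
  else 0

theorem ofBounded_apply {f : ℝ → ℂ} (h : MemLp f ∞ (volume : Measure ℝ)) (φ : 𝓢(ℝ, ℂ)) :
    ofBounded f φ = ∫ ξ, φ ξ * f ξ := by
  rw [ofBounded, dif_pos h, Lp.toTemperedDistribution_apply]
  refine integral_congr_ae ?_
  filter_upwards [h.coeFn_toLp] with ξ hξ
  rw [hξ, smul_eq_mul]

/-- `R = S ∗ T`, for tempered distributions `S`, `T` on `ℝ` whose Fourier transforms are functions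
with a temperate product: `R` is the inverse Fourier transform of the product. -/
def IsConvolution (S T R : 𝓢'(ℝ, ℂ)) : Prop :=
  ∃ f g : ℝ → ℂ, IsFunction (𝓕 S) f ∧ IsFunction (𝓕 T) g ∧ IsFunction (𝓕 R) (fun ξ => f ξ * g ξ)

/-! ### The symbols and kernels of the fractional Eringen operator

The symbols are written in the angular frequency `η`, that is for the Fourier transform
`∫ exp (-i x η) w(x) dx`. Mathlib's transform `𝓕 w (ξ) = ∫ exp (-2 π i x ξ) w(x) dx` is its value
at `η = 2 π ξ`, so the distribution with angular symbol `m` is `𝓕⁻ (ξ ↦ m (2 π ξ))`. -/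

/-- The constant `a_α = -cos (α π / 2)`. -/
def aConst (α : ℝ) : ℝ := -Real.cos (α * Real.pi / 2)

/-- The symbol `1 / (1 + a_α |η| ^ α)` of `L^α_x`. -/
def symbolL (α η : ℝ) : ℝ := 1 / (1 + aConst α * |η| ^ α)

/-- The frequency function `h_α(η) = |η| / √(1 + a_α |η| ^ α)`. -/
def freq (α η : ℝ) : ℝ := |η| / √(1 + aConst α * |η| ^ α)

/-- The Heaviside function. -/
def heaviside (t : ℝ) : ℝ := if 0 ≤ t then 1 else 0

/-- The convolution kernel of `L^α_x`. -/
def kernelL (α : ℝ) : 𝓢'(ℝ, ℂ) :=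
  𝓕⁻ (ofBounded fun ξ => (symbolL α (2 * Real.pi * ξ) : ℂ))

/-- `E₀(t)`, the inverse Fourier transform of `cos (h_α(η) t) H(t)`. -/
def E₀ (α t : ℝ) : 𝓢'(ℝ, ℂ) :=
  𝓕⁻ (ofBounded fun ξ => ((Real.cos (freq α (2 * Real.pi * ξ) * t) * heaviside t : ℝ) : ℂ))

/-- `E₁(t)`, the inverse Fourier transform of `sin (h_α(η) t) / h_α(η) H(t)` (the value at the
single frequency `η = 0` plays no role). -/
def E₁ (α t : ℝ) : 𝓢'(ℝ, ℂ) :=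
  𝓕⁻ (ofBounded fun ξ =>
    ((Real.sin (freq α (2 * Real.pi * ξ) * t) / freq α (2 * Real.pi * ξ) * heaviside t : ℝ) : ℂ))

theorem aConst_pos {α : ℝ} (hα : α ∈ Set.Ioo (1 : ℝ) 3) : 0 < aConst α := by
  obtain ⟨h1, h3⟩ := hα
  have hpi := Real.pi_pos
  have := Real.cos_neg_of_pi_div_two_lt_of_lt (x := α * Real.pi / 2) (by nlinarith) (by nlinarith)
  simpa [aConst] using this

theorem measurable_freq (α : ℝ) : Measurable (freq α) := by
  unfold freq
  fun_prop

/-- For the relevant `α`, the symbol in `kernelL` is bounded. -/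
theorem memLp_symbolL {α : ℝ} (hα : α ∈ Set.Ioo (1 : ℝ) 3) :
    MemLp (fun ξ : ℝ => (symbolL α (2 * Real.pi * ξ) : ℂ)) ∞ (volume : Measure ℝ) := by
  refine memLp_top_of_bound (C := 1) ?_ (Filter.Eventually.of_forall fun ξ => ?_)
  · refine Measurable.aestronglyMeasurable ?_
    unfold symbolL
    fun_prop
  · have ha := aConst_pos hα
    have hp : 0 ≤ aConst α * |2 * Real.pi * ξ| ^ α := by positivity
    rw [Complex.norm_real, Real.norm_eq_abs, symbolL, abs_of_nonneg (by positivity)]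
    exact (div_le_one (by linarith)).2 (by linarith)

/-- The symbol in `E₀` is bounded. -/
theorem memLp_symbolE₀ (α t : ℝ) :
    MemLp (fun ξ : ℝ => ((Real.cos (freq α (2 * Real.pi * ξ) * t) * heaviside t : ℝ) : ℂ))
      ∞ (volume : Measure ℝ) := by
  refine memLp_top_of_bound (C := 1) ?_ (Filter.Eventually.of_forall fun ξ => ?_)
  · have := measurable_freq α
    refine Measurable.aestronglyMeasurable ?_
    fun_prop
  · rw [Complex.norm_real, Real.norm_eq_abs, heaviside]
    split_ifs
    · simpa using Real.abs_cos_le_one _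
    · simp

/-- The symbol in `E₁` is bounded. -/
theorem memLp_symbolE₁ (α t : ℝ) :
    MemLp (fun ξ : ℝ => ((Real.sin (freq α (2 * Real.pi * ξ) * t) / freq α (2 * Real.pi * ξ)
      * heaviside t : ℝ) : ℂ)) ∞ (volume : Measure ℝ) := by
  refine memLp_top_of_bound (C := |t|) ?_ (Filter.Eventually.of_forall fun ξ => ?_)
  · have := measurable_freq α
    refine Measurable.aestronglyMeasurable ?_
    fun_prop
  · rw [Complex.norm_real, Real.norm_eq_abs, heaviside]
    split_ifs
    · rw [mul_one, abs_div]
      refine div_le_of_le_mul₀ (abs_nonneg _) (abs_nonneg _) ?_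
      calc |Real.sin (freq α (2 * Real.pi * ξ) * t)|
          ≤ |freq α (2 * Real.pi * ξ) * t| := Real.abs_sin_le_abs
        _ = |t| * |freq α (2 * Real.pi * ξ)| := by rw [abs_mul, mul_comm]
    · simp

/-! ### Functions of time with values in the Sobolev space `H^s(ℝ)`

The space `H^s(ℝ)` is `{w | MemSobolev s 2 w}`; its norm is the `L²`-norm of the function
`besselPotential ℝ ℂ s w`. Hence a map `U` into `H^s(ℝ)` is the same as the map
`G t = besselPotential ℝ ℂ s (U t)` into `L²(ℝ)`. -/

/-- `U ∈ L¹_loc(ℝ, H^s(ℝ))` (in the sense of Bochner). -/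
def IsL1Loc (s : ℝ) (U : ℝ → 𝓢'(ℝ, ℂ)) : Prop :=
  ∃ G : ℝ → Lp ℂ 2 (volume : Measure ℝ),
    (∀ t, besselPotential ℝ ℂ s (U t) = (G t : 𝓢'(ℝ, ℂ))) ∧ LocallyIntegrable G

/-- `U ∈ C((0,∞); H^s(ℝ))`. -/
def IsContinuousSobolev (s : ℝ) (U : ℝ → 𝓢'(ℝ, ℂ)) : Prop :=
  ∃ G : ℝ → Lp ℂ 2 (volume : Measure ℝ),
    (∀ t ∈ Set.Ioi (0 : ℝ), besselPotential ℝ ℂ s (U t) = (G t : 𝓢'(ℝ, ℂ))) ∧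
      ContinuousOn G (Set.Ioi 0)

/-- `U ∈ C^∞((0,∞); 𝓢'(ℝ))`: all functions `t ↦ ⟨U(t), φ⟩` are smooth on `(0,∞)`. -/
def IsSmoothTempered (U : ℝ → 𝓢'(ℝ, ℂ)) : Prop :=
  ∀ φ : 𝓢(ℝ, ℂ), ContDiffOn ℝ ∞ (fun t => U t φ) (Set.Ioi 0)

/-- The distribution `u` on space-time is the function `t ↦ U(t)` of time:
`⟨u, Φ⟩ = ∫ ⟨U(t), Φ(·, t)⟩ dt` for all test functions `Φ ∈ C_c^∞(ℝ²)`. -/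
def IsGivenBy (u : 𝓢'(ℝ × ℝ, ℂ)) (U : ℝ → 𝓢'(ℝ, ℂ)) : Prop :=
  ∀ Φ : 𝓢(ℝ × ℝ, ℂ), HasCompactSupport Φ →
    Integrable (fun t => U t (slice t Φ)) ∧ u Φ = ∫ t, U t (slice t Φ)

/-! ### The operator and the generalized Cauchy problem -/

/-- `z = L^α_x ∂_x² w` for distributions on space. -/
def IsLapEringen (α : ℝ) (w z : 𝓢'(ℝ, ℂ)) : Prop :=
  IsConvolution (kernelL α) (derivCLM ℂ (derivCLM ℂ w)) z

/-- `u ∈ L¹_loc(ℝ, H^s(ℝ)) ∩ 𝓢'(ℝ²)` and `P u = f` in `𝓢'(ℝ²)`, where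
`P u = ∂_t² u - L^α_x ∂_x² u` and `L^α_x ∂_x²` acts on `u` at each time. -/
def IsEringenOp (α s : ℝ) (u f : 𝓢'(ℝ × ℝ, ℂ)) : Prop :=
  ∃ U W : ℝ → 𝓢'(ℝ, ℂ), ∃ w : 𝓢'(ℝ × ℝ, ℂ),
    IsL1Loc s U ∧ IsGivenBy u U ∧
    (∀ t, IsLapEringen α (U t) (W t)) ∧ IsGivenBy w W ∧
    ∂_{((0, 1) : ℝ × ℝ)} (∂_{((0, 1) : ℝ × ℝ)} u) - w = f

/-- `u ∈ L¹_loc(ℝ, H^s(ℝ)) ∩ 𝓢'(ℝ²)` is supported in `t ≥ 0` and solves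
`P u = u₀ ⊗ δ' + v₀ ⊗ δ`. -/
def IsSolution (α s : ℝ) (u₀ v₀ : 𝓢'(ℝ, ℂ)) (u : 𝓢'(ℝ × ℝ, ℂ)) : Prop :=
  IsEringenOp α s u (tensorDeltaDeriv u₀ + tensorDelta v₀) ∧
    Distribution.dsupport u ⊆ {p : ℝ × ℝ | 0 ≤ p.2}

end FractionalEringen

end

/-!
The Cauchy problem is diagonal on the Fourier side: for a function of time `U` with values in
`H^s(ℝ)`, every Fourier transform `𝓕 (U t)` is a function, and `L^α_x ∂_x²` multiplies it by
`-h_α²`. So the problem is `y'' + h_α(ξ)² y = y₀ δ' + y₁ δ` for each frequency `ξ`, whose solution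
supported in `t ≥ 0` is `H(t) (cos(h_α t) y₀ + sin(h_α t) / h_α y₁)`.

*Existence.* All functions of `ξ` that occur are tempered (`IsTempered`): they are integrable
against a negative power of `1 + |ξ|`. For tempered `g₀`, `g₁`, the wave
`cos(h_α t) g₀ + sin(h_α t) / h_α g₁` is paired with the partial inverse Fourier transform of a
space-time test function, and the pairing is differentiated under the integral sign
(`hasDerivAt_wavePairing`). Two integrations by parts on `(0, ∞)` leave the initial data as boundary
terms (`integral_wavePairing_dt_dt`), which is the equation (`waveDistribution_equation`).

*Sobolev regularity.* The symbol `sin(h_α t) / h_α` is `O(|ξ|^(α/2 - 1))` at infinity, locally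
uniformly in `t` (`exists_bound_sin_div_mul_rpow`), so the wave stays in `H^s` when the second
datum is in `H^(s - 1 + α/2)`; continuity in time is dominated convergence
(`exists_continuous_mul_Lp`).

*Uniqueness.* Let `d` be the difference of two solutions, given by functions `F t` on the Fourier
side, up to a Bessel weight. Since `d` vanishes for `t < 0`, so does `F`. Testing `∂_t² d = e` with
products of test functions gives, for almost every `ξ`,
`∫ χ''(t) F t ξ dt = -h_α(ξ)² ∫ χ(t) F t ξ dt` (`timeAverage_deriv_deriv`). As only `t ≥ 0` matters,
a test function `χ` may be written as `χₙ^(2n)` there, where the repeated backward primitive `χₙ`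
is `O(T^(2n) / (2n)!)` (`exists_deriv_deriv_eq`). Hence `∫ χ F = (-h_α²)ⁿ ∫ χₙ F` for all `n`. On
the set where `h_α` is bounded by `R`, the factor `R^(2n)` loses against the factorial, so
`∫ χ F = 0` for every `χ` (`eq_zero_of_eq_pow_mul`), and `F = 0` almost everywhere. This needs no
smoothness of `h_α`, which is singular at `ξ = 0`, and only integrability of `F` in time.
-/


/-! ### Compactly supported test functions and tempered distributions -/

namespace FractionalEringen

section Density

variable {E : Type*} [NormedAddCommGroup E] [NormedSpace ℝ E] [FiniteDimensional ℝ E]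

variable (E) in
/-- A smooth cutoff, equal to `1` on the unit ball and supported in the ball of radius `2`,
as a complex Schwartz function. -/
noncomputable def unitCutoff : 𝓢(E, ℂ) :=
  HasCompactSupport.toSchwartzMap
    (f := fun x => ((⟨1, 2, one_pos, one_lt_two⟩ : ContDiffBump (0 : E)) x : ℂ))
    ((ContDiffBump.hasCompactSupport _).comp_left (g := Complex.ofReal) rfl)
    (Complex.ofRealCLM.contDiff.comp (ContDiffBump.contDiff _))

theorem hasCompactSupport_unitCutoff : HasCompactSupport (unitCutoff E) :=
  (ContDiffBump.hasCompactSupport _).comp_left (g := Complex.ofReal) rfl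

theorem norm_unitCutoff_sub_one_le (x : E) : ‖unitCutoff E x - 1‖ ≤ ‖x‖ := by
  set b : ContDiffBump (0 : E) := ⟨1, 2, one_pos, one_lt_two⟩
  have hb : unitCutoff E x = (b x : ℂ) := rfl
  rw [hb, ← Complex.ofReal_one, ← Complex.ofReal_sub, Complex.norm_real, Real.norm_eq_abs]
  by_cases hx : ‖x‖ ≤ 1
  · rw [b.one_of_mem_closedBall (by simpa [b] using hx)]
    simp
  · have h0 := b.nonneg (x := x)
    have h1 := b.le_one (x := x)
    rw [abs_of_nonpos (by linarith)]
    linarith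

theorem norm_iteratedFDeriv_unitCutoff_comp_smul_sub_one_le {c : ℝ} (hc : 0 ≤ c) (hc1 : c ≤ 1)
    {i : ℕ} (hi : i ≠ 0) (x : E) :
    ‖iteratedFDeriv ℝ i (fun y : E => unitCutoff E (c • y) - 1) x‖
      ≤ c * SchwartzMap.seminorm ℝ 0 i (unitCutoff E) := by
  have h1 : iteratedFDeriv ℝ i (fun y : E => unitCutoff E (c • y) - 1) x
      = iteratedFDeriv ℝ i (fun y : E => unitCutoff E (c • y)) x := by
    have := iteratedFDeriv_add_apply (𝕜 := ℝ) (i := i) (x := x)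
      (f := fun y : E => unitCutoff E (c • y)) (g := fun _ => (-1 : ℂ))
      (((unitCutoff E).smooth i).comp (contDiff_const_smul c)).contDiffAt contDiff_const.contDiffAt
    rw [iteratedFDeriv_const_of_ne hi] at this
    simpa [sub_eq_add_neg, Pi.add_def] using this
  set g : E →L[ℝ] E := c • ContinuousLinearMap.id ℝ E
  have h2 : iteratedFDeriv ℝ i (fun y : E => unitCutoff E (c • y)) x
      = (iteratedFDeriv ℝ i (unitCutoff E) (g x)).compContinuousLinearMap fun _ => g :=
    g.iteratedFDeriv_comp_right ((unitCutoff E).smooth i) x le_rfl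
  rw [h1, h2]
  refine (ContinuousMultilinearMap.norm_compContinuousLinearMap_le _ _).trans ?_
  have hg : ‖g‖ ≤ c := by
    refine (norm_smul_le c (ContinuousLinearMap.id ℝ E)).trans ?_
    rw [Real.norm_of_nonneg hc]
    exact mul_le_of_le_one_right hc ContinuousLinearMap.norm_id_le
  rw [Finset.prod_const, Finset.card_univ, Fintype.card_fin, mul_comm]
  have hp : ‖g‖ ^ i ≤ c :=
    (pow_le_pow_left₀ (norm_nonneg _) hg i).trans (pow_le_of_le_one hc hc1 hi)
  gcongr
  exact SchwartzMap.norm_iteratedFDeriv_le_seminorm ℝ (unitCutoff E) i (g x)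

/-- Multiplication of a Schwartz function by the cutoff of size `1 / c`. -/
noncomputable def cutoffMul (c : ℝ) (Φ : 𝓢(E, ℂ)) : 𝓢(E, ℂ) :=
  SchwartzMap.smulLeftCLM ℂ (fun y : E => unitCutoff E (c • y)) Φ

theorem hasTemperateGrowth_unitCutoff_comp_smul (c : ℝ) :
    (fun y : E => unitCutoff E (c • y)).HasTemperateGrowth :=
  (unitCutoff E).hasTemperateGrowth.comp (c • ContinuousLinearMap.id ℝ E).hasTemperateGrowth

theorem cutoffMul_apply (c : ℝ) (Φ : 𝓢(E, ℂ)) (x : E) :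
    cutoffMul c Φ x = unitCutoff E (c • x) * Φ x := by
  rw [cutoffMul, SchwartzMap.smulLeftCLM_apply_apply (hasTemperateGrowth_unitCutoff_comp_smul c),
    smul_eq_mul]

theorem hasCompactSupport_cutoffMul {c : ℝ} (hc : c ≠ 0) (Φ : 𝓢(E, ℂ)) :
    HasCompactSupport (cutoffMul c Φ) := by
  have h : (cutoffMul c Φ : E → ℂ) = (fun y : E => unitCutoff E (c • y)) * Φ :=
    funext (cutoffMul_apply c Φ)
  rw [h]
  exact (hasCompactSupport_unitCutoff.comp_smul hc).mul_right

/-- The error of the cutoff is linear in `c`: a derivative that falls on the cutoff produces a factor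
`c`, and `1 - χ(c x)` itself is at most `c ‖x‖`, at the price of one more power of `‖x‖`. -/
theorem seminorm_cutoffMul_sub_le (k n : ℕ) (Φ : 𝓢(E, ℂ)) :
    ∃ C : ℝ, ∀ c : ℝ, 0 ≤ c → c ≤ 1 →
      SchwartzMap.seminorm ℂ k n (cutoffMul c Φ - Φ) ≤ c * C := by
  refine ⟨∑ i ∈ Finset.range (n + 1), (n.choose i : ℝ) *
    (SchwartzMap.seminorm ℝ 0 i (unitCutoff E) * SchwartzMap.seminorm ℝ k (n - i) Φ
      + SchwartzMap.seminorm ℝ (k + 1) (n - i) Φ), fun c hc hc1 => ?_⟩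
  refine SchwartzMap.seminorm_le_bound ℂ k n _ (by positivity) fun x => ?_
  have h : ((cutoffMul c Φ - Φ : 𝓢(E, ℂ)) : E → ℂ)
      = fun y => (unitCutoff E (c • y) - 1) * Φ y := by
    ext y
    rw [sub_apply, cutoffMul_apply]
    ring
  rw [h, Finset.mul_sum]
  have hsm : ContDiff ℝ n (fun y : E => unitCutoff E (c • y) - 1) :=
    (((unitCutoff E).smooth n).comp (contDiff_const_smul c)).sub contDiff_const
  refine (mul_le_mul_of_nonneg_left (norm_iteratedFDeriv_mul_le hsm (Φ.smooth n) x le_rfl)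
    (by positivity)).trans ?_
  rw [Finset.mul_sum]
  refine Finset.sum_le_sum fun i _ => ?_
  have h1 := SchwartzMap.le_seminorm ℝ k (n - i) Φ x
  have h2 := SchwartzMap.le_seminorm ℝ (k + 1) (n - i) Φ x
  have h3 : (0 : ℝ) ≤ SchwartzMap.seminorm ℝ 0 i (unitCutoff E) := by positivity
  have h4 : (0 : ℝ) ≤ SchwartzMap.seminorm ℝ k (n - i) Φ := by positivity
  have h5 : (0 : ℝ) ≤ SchwartzMap.seminorm ℝ (k + 1) (n - i) Φ := by positivity
  have key : ‖iteratedFDeriv ℝ i (fun y : E => unitCutoff E (c • y) - 1) x‖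
      * (‖x‖ ^ k * ‖iteratedFDeriv ℝ (n - i) Φ x‖)
      ≤ c * (SchwartzMap.seminorm ℝ 0 i (unitCutoff E) * SchwartzMap.seminorm ℝ k (n - i) Φ
        + SchwartzMap.seminorm ℝ (k + 1) (n - i) Φ) := by
    rcases eq_or_ne i 0 with rfl | hi
    · rw [norm_iteratedFDeriv_zero]
      have h6 : ‖unitCutoff E (c • x) - 1‖ ≤ c * ‖x‖ := by
        simpa [norm_smul, abs_of_nonneg hc] using norm_unitCutoff_sub_one_le (c • x)
      calc _ ≤ c * ‖x‖ * (‖x‖ ^ k * ‖iteratedFDeriv ℝ (n - 0) Φ x‖) := by gcongr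
        _ = c * (‖x‖ ^ (k + 1) * ‖iteratedFDeriv ℝ (n - 0) Φ x‖) := by ring
        _ ≤ _ := by
          refine mul_le_mul_of_nonneg_left ?_ hc
          nlinarith
    · have h6 := norm_iteratedFDeriv_unitCutoff_comp_smul_sub_one_le hc hc1 hi x
      calc _ ≤ c * SchwartzMap.seminorm ℝ 0 i (unitCutoff E)
            * SchwartzMap.seminorm ℝ k (n - i) Φ := by gcongr
        _ ≤ _ := by
          rw [mul_assoc]
          refine mul_le_mul_of_nonneg_left ?_ hc
          linarith
  calc _ = (n.choose i : ℝ) * (‖iteratedFDeriv ℝ i (fun y : E => unitCutoff E (c • y) - 1) x‖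
      * (‖x‖ ^ k * ‖iteratedFDeriv ℝ (n - i) Φ x‖)) := by ring
    _ ≤ (n.choose i : ℝ) * (c * (SchwartzMap.seminorm ℝ 0 i (unitCutoff E)
        * SchwartzMap.seminorm ℝ k (n - i) Φ + SchwartzMap.seminorm ℝ (k + 1) (n - i) Φ)) := by
      gcongr
    _ = _ := by ring

theorem tendsto_cutoffMul (Φ : 𝓢(E, ℂ)) :
    Filter.Tendsto (fun n : ℕ => cutoffMul (1 / ((n : ℝ) + 1)) Φ) Filter.atTop (nhds Φ) := by
  rw [(schwartz_withSeminorms ℂ E ℂ).tendsto_nhds _ Φ]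
  rintro ⟨k, n⟩ ε hε
  obtain ⟨C, hC⟩ := seminorm_cutoffMul_sub_le k n Φ
  have ht : Filter.Tendsto (fun n : ℕ => 1 / ((n : ℝ) + 1) * C) Filter.atTop (nhds 0) := by
    simpa using tendsto_one_div_add_atTop_nhds_zero_nat.mul_const C
  filter_upwards [ht.eventually_lt_const hε] with m hm
  refine lt_of_le_of_lt (hC _ (by positivity) ?_) hm
  rw [div_le_one (by positivity)]
  linarith [(Nat.cast_nonneg m : (0 : ℝ) ≤ m)]

/-- Test functions are dense among Schwartz functions, so a tempered distribution is determined by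
its values on them. -/
theorem eq_of_eq_on_hasCompactSupport {S T : 𝓢'(E, ℂ)}
    (h : ∀ Φ : 𝓢(E, ℂ), HasCompactSupport Φ → S Φ = T Φ) : S = T := by
  ext Φ
  have hS := (S.continuous.tendsto Φ).comp (tendsto_cutoffMul Φ)
  have hT := (T.continuous.tendsto Φ).comp (tendsto_cutoffMul Φ)
  refine tendsto_nhds_unique hS (hT.congr fun n => (h _ ?_).symm)
  exact hasCompactSupport_cutoffMul (by positivity) Φ

/-- A distribution annihilates the test functions supported away from its support. The definition
of the support gives this only locally; a partition of unity makes it global. -/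
theorem apply_eq_zero_of_tsupport_subset_compl_dsupport {T : 𝓢'(E, ℂ)} {Φ : 𝓢(E, ℂ)}
    (hΦ : HasCompactSupport Φ) (h : tsupport Φ ⊆ (Distribution.dsupport T)ᶜ) : T Φ = 0 := by
  have hx : ∀ x ∈ tsupport Φ, ∃ s : Set E,
      Distribution.IsVanishingOn T s ∧ IsOpen s ∧ x ∈ s := fun x hx =>
    (Distribution.notMem_dsupport_iff x).1 (h hx)
  choose! V hV hVo hxV using hx
  obtain ⟨K, hK, hcov⟩ := hΦ.isCompact.elim_nhds_subcover V
    fun x hx => (hVo x hx).mem_nhds (hxV x hx)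
  have hcov' : tsupport Φ ⊆ ⋃ i : K, V i := by
    intro x hx
    obtain ⟨y, hy, hxy⟩ := Set.mem_iUnion₂.1 (hcov hx)
    exact Set.mem_iUnion.2 ⟨⟨y, hy⟩, hxy⟩
  obtain ⟨f, hf⟩ := SmoothPartitionOfUnity.exists_isSubordinate (modelWithCornersSelf ℝ E)
    (isClosed_tsupport Φ) (fun i : K => V i) (fun i => hVo i (hK i i.2)) hcov'
  have hsm : ∀ i : K, ContDiff ℝ ∞ (fun x => (f i x : ℂ) * Φ x) := fun i =>
    (Complex.ofRealCLM.contDiff.comp (f i).contMDiff.contDiff).mul (Φ.smooth ⊤)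
  have hcs : ∀ i : K, HasCompactSupport (fun x => (f i x : ℂ) * Φ x) := fun i => hΦ.mul_left
  have hsum : Φ = ∑ i : K, (hcs i).toSchwartzMap (hsm i) := by
    ext x
    rw [sum_apply]
    change Φ x = ∑ i : K, (f i x : ℂ) * Φ x
    rw [← Finset.sum_mul]
    by_cases hx : x ∈ tsupport Φ
    · have h1 := f.sum_eq_one hx
      rw [finsum_eq_sum_of_fintype] at h1
      rw [← Complex.ofReal_sum, h1]
      simp
    · rw [image_eq_zero_of_notMem_tsupport hx, mul_zero]
  rw [hsum, map_sum]
  refine Finset.sum_eq_zero fun i _ => hV i (hK i i.2) _ ?_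
  refine (closure_mono ?_).trans (hf i)
  intro x hx
  have hx' : (f i x : ℂ) * Φ x ≠ 0 := hx
  exact fun h0 => hx' (by simp [h0])

end Density

/-! ### Tempered functions and the Fourier side of the definitions -/

/-- A measurable function whose product with some negative power of `1 + |ξ|` is integrable. Such
a function pairs with all Schwartz functions; all Fourier transforms below are of this kind. -/
def IsTempered (g : ℝ → ℂ) : Prop :=
  AEStronglyMeasurable g ∧ ∃ N : ℕ, Integrable fun ξ => ‖g ξ‖ / (1 + |ξ|) ^ N

theorem IsTempered.mul_left {m g : ℝ → ℂ} (hg : IsTempered g) (hm : AEStronglyMeasurable m)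
    (hbd : ∃ (C : ℝ) (k : ℕ), ∀ ξ, ‖m ξ‖ ≤ C * (1 + |ξ|) ^ k) :
    IsTempered fun ξ => m ξ * g ξ := by
  obtain ⟨hgm, N, hN⟩ := hg
  obtain ⟨C, k, hC⟩ := hbd
  refine ⟨hm.mul hgm, N + k, (hN.const_mul C).mono' ?_ (Filter.Eventually.of_forall fun ξ => ?_)⟩
  · exact (hm.mul hgm).norm.div₀ (by fun_prop)
  · have h : (0 : ℝ) < 1 + |ξ| := by positivity
    rw [Real.norm_of_nonneg (by positivity), norm_mul, pow_add, div_le_iff₀ (by positivity)]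
    calc ‖m ξ‖ * ‖g ξ‖ ≤ C * (1 + |ξ|) ^ k * ‖g ξ‖ := by gcongr; exact hC ξ
      _ = _ := by field_simp

theorem IsTempered.mul_left_of_hasTemperateGrowth {m g : ℝ → ℂ} (hg : IsTempered g)
    (hm : m.HasTemperateGrowth) : IsTempered fun ξ => m ξ * g ξ := by
  obtain ⟨k, C, hC⟩ := hm.2 0
  refine hg.mul_left hm.1.continuous.aestronglyMeasurable ⟨C, k, fun ξ => ?_⟩
  simpa using hC ξ

theorem IsTempered.of_norm_le {f g : ℝ → ℂ} (hf : AEStronglyMeasurable f) (hg : IsTempered g)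
    (h : ∀ ξ, ‖f ξ‖ ≤ ‖g ξ‖) : IsTempered f := by
  obtain ⟨hgm, N, hN⟩ := hg
  refine ⟨hf, N, hN.mono' (hf.norm.div₀ (by fun_prop)) (Filter.Eventually.of_forall fun ξ => ?_)⟩
  rw [Real.norm_of_nonneg (by positivity)]
  gcongr
  exact h ξ

theorem IsTempered.add {f g : ℝ → ℂ} (hf : IsTempered f) (hg : IsTempered g) :
    IsTempered fun ξ => f ξ + g ξ := by
  obtain ⟨hfm, N, hN⟩ := hf
  obtain ⟨hgm, M, hM⟩ := hg
  refine ⟨hfm.add hgm, N + M, (hN.add hM).mono' ?_ (Filter.Eventually.of_forall fun ξ => ?_)⟩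
  · exact (hfm.add hgm).norm.div₀ (by fun_prop)
  · have h : (1 : ℝ) ≤ 1 + |ξ| := by linarith [abs_nonneg ξ]
    have h0 : (0 : ℝ) < 1 + |ξ| := by linarith
    rw [Real.norm_of_nonneg (by positivity)]
    calc ‖f ξ + g ξ‖ / (1 + |ξ|) ^ (N + M)
        ≤ (‖f ξ‖ + ‖g ξ‖) / (1 + |ξ|) ^ (N + M) := by gcongr; exact norm_add_le _ _
      _ = ‖f ξ‖ / (1 + |ξ|) ^ (N + M) + ‖g ξ‖ / (1 + |ξ|) ^ (N + M) := add_div _ _ _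
      _ ≤ ‖f ξ‖ / (1 + |ξ|) ^ N + ‖g ξ‖ / (1 + |ξ|) ^ M := by
        gcongr <;> first | exact h | omega

theorem isTempered_of_memLp_two {g : ℝ → ℂ} (hg : MemLp g 2 (volume : Measure ℝ)) :
    IsTempered g := by
  -- Cauchy–Schwarz against a power of `1 + |ξ|` that is square integrable.
  obtain ⟨k, hk⟩ := (inferInstance :
    (volume : Measure ℝ).HasTemperateGrowth).exists_eLpNorm_lt_top 2
  refine ⟨hg.1, k, ?_⟩
  have hw : MemLp (fun ξ : ℝ => (1 + ‖ξ‖) ^ (-k : ℝ)) 2 (volume : Measure ℝ) := by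
    refine ⟨Measurable.aestronglyMeasurable (by fun_prop), hk⟩
  refine (hg.norm.integrable_mul hw).congr (Filter.Eventually.of_forall fun ξ => ?_)
  have h0 : (0 : ℝ) ≤ 1 + |ξ| := by positivity
  simp only [Pi.mul_apply, Real.norm_eq_abs]
  rw [Real.rpow_neg h0, Real.rpow_natCast, div_eq_mul_inv]

theorem one_add_abs_pow_mul_le (N : ℕ) (φ : 𝓢(ℝ, ℂ)) (ξ : ℝ) :
    (1 + |ξ|) ^ N * ‖φ ξ‖
      ≤ 2 ^ N * (Finset.Iic (N, 0)).sup (schwartzSeminormFamily ℂ ℝ ℂ) φ := by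
  have := SchwartzMap.one_add_le_sup_seminorm_apply (𝕜 := ℂ) (m := (N, 0)) (k := N) (n := 0)
    le_rfl le_rfl φ ξ
  rwa [norm_iteratedFDeriv_zero, Real.norm_eq_abs] at this

theorem integrable_mul_of_decay {ψ g : ℝ → ℂ} {N : ℕ} {C : ℝ} (hψ : AEStronglyMeasurable ψ)
    (hC : ∀ ξ, (1 + |ξ|) ^ N * ‖ψ ξ‖ ≤ C) (hg : AEStronglyMeasurable g)
    (hN : Integrable fun ξ => ‖g ξ‖ / (1 + |ξ|) ^ N) :
    Integrable (fun ξ => ψ ξ * g ξ) ∧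
      ‖∫ ξ, ψ ξ * g ξ‖ ≤ C * ∫ ξ, ‖g ξ‖ / (1 + |ξ|) ^ N := by
  have hb : ∀ ξ, ‖ψ ξ * g ξ‖ ≤ C * (‖g ξ‖ / (1 + |ξ|) ^ N) := fun ξ => by
    have h0 : (0 : ℝ) < 1 + |ξ| := by positivity
    calc ‖ψ ξ * g ξ‖ = ((1 + |ξ|) ^ N * ‖ψ ξ‖) * (‖g ξ‖ / (1 + |ξ|) ^ N) := by
          rw [norm_mul]; field_simp
      _ ≤ _ := by gcongr; exact hC ξ
  refine ⟨(hN.const_mul C).mono' (hψ.mul hg) (Filter.Eventually.of_forall hb), ?_⟩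
  rw [← integral_const_mul]
  exact norm_integral_le_of_norm_le (hN.const_mul C) (Filter.Eventually.of_forall hb)

theorem IsTempered.integrable_mul {g : ℝ → ℂ} (hg : IsTempered g) (φ : 𝓢(ℝ, ℂ)) :
    Integrable fun ξ => φ ξ * g ξ := by
  obtain ⟨hgm, N, hN⟩ := hg
  exact (integrable_mul_of_decay φ.continuous.aestronglyMeasurable
    (one_add_abs_pow_mul_le N φ) hgm hN).1

/-- Integration against a tempered function, as a continuous linear form on Schwartz functions. -/
noncomputable def IsTempered.toCLM {g : ℝ → ℂ} (hg : IsTempered g) : 𝓢(ℝ, ℂ) →L[ℂ] ℂ :=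
  SchwartzMap.mkCLMtoNormedSpace (fun φ => ∫ ξ, φ ξ * g ξ)
    (fun φ ψ => by
      rw [← integral_add (hg.integrable_mul φ) (hg.integrable_mul ψ)]
      refine integral_congr_ae (Filter.Eventually.of_forall fun ξ => ?_)
      simp only [add_apply]
      ring)
    (fun c φ => by
      rw [smul_eq_mul, ← integral_const_mul]
      refine integral_congr_ae (Filter.Eventually.of_forall fun ξ => ?_)
      simp only [smul_apply, smul_eq_mul, RingHom.id_apply]
      ring)
    (by
      obtain ⟨hgm, N, hN⟩ := hg
      refine ⟨Finset.Iic (N, 0), 2 ^ N * ∫ ξ, ‖g ξ‖ / (1 + |ξ|) ^ N, by positivity, fun φ => ?_⟩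
      refine (integrable_mul_of_decay φ.continuous.aestronglyMeasurable
        (one_add_abs_pow_mul_le N φ) hgm hN).2.trans (le_of_eq ?_)
      ring)

open Classical in
/-- The tempered distribution given by a tempered function (and `0` for other functions). -/
noncomputable def ofTempered (g : ℝ → ℂ) : 𝓢'(ℝ, ℂ) :=
  if hg : IsTempered g then ContinuousLinearMap.toPointwiseConvergenceCLM _ _ _ _ hg.toCLM else 0

theorem ofTempered_apply {g : ℝ → ℂ} (hg : IsTempered g) (φ : 𝓢(ℝ, ℂ)) :
    ofTempered g φ = ∫ ξ, φ ξ * g ξ := by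
  rw [ofTempered, dif_pos hg]
  rfl

theorem isFunction_ofTempered {g : ℝ → ℂ} (hg : IsTempered g) : IsFunction (ofTempered g) g :=
  fun φ => ⟨hg.integrable_mul φ, ofTempered_apply hg φ⟩

theorem isFunction_ofBounded {f : ℝ → ℂ} (hf : MemLp f ∞ (volume : Measure ℝ)) :
    IsFunction (ofBounded f) f := fun φ =>
  ⟨memLp_one_iff_integrable.1 (hf.mul (φ.memLp 1)), ofBounded_apply hf φ⟩

theorem IsFunction.sub {S T : 𝓢'(ℝ, ℂ)} {f g : ℝ → ℂ} (hS : IsFunction S f)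
    (hT : IsFunction T g) : IsFunction (S - T) fun ξ => f ξ - g ξ := fun φ => by
  simp only [mul_sub]
  refine ⟨(hS φ).1.sub (hT φ).1, ?_⟩
  rw [integral_sub (hS φ).1 (hT φ).1, ← (hS φ).2, ← (hT φ).2]
  rfl

theorem IsFunction.add {S T : 𝓢'(ℝ, ℂ)} {f g : ℝ → ℂ} (hS : IsFunction S f)
    (hT : IsFunction T g) : IsFunction (S + T) fun ξ => f ξ + g ξ := fun φ => by
  simp only [mul_add]
  refine ⟨(hS φ).1.add (hT φ).1, ?_⟩
  rw [integral_add (hS φ).1 (hT φ).1, ← (hS φ).2, ← (hT φ).2]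
  rfl

theorem IsFunction.congr {S : 𝓢'(ℝ, ℂ)} {f g : ℝ → ℂ} (hS : IsFunction S f)
    (h : f =ᵐ[volume] g) : IsFunction S g := fun φ => by
  have h' : (fun ξ => φ ξ * f ξ) =ᵐ[volume] fun ξ => φ ξ * g ξ := by
    filter_upwards [h] with ξ hξ
    rw [hξ]
  exact ⟨(hS φ).1.congr h', (hS φ).2.trans (integral_congr_ae h')⟩

theorem IsFunction.eq {S T : 𝓢'(ℝ, ℂ)} {f : ℝ → ℂ} (hS : IsFunction S f) (hT : IsFunction T f) :
    S = T := by
  ext φ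
  rw [(hS φ).2, (hT φ).2]

/-- A complex Schwartz function equal to a given smooth compactly supported real function. -/
noncomputable def testFunction {χ : ℝ → ℝ} (h1 : ContDiff ℝ ∞ χ) (h2 : HasCompactSupport χ) :
    𝓢(ℝ, ℂ) :=
  HasCompactSupport.toSchwartzMap (f := fun x => (χ x : ℂ))
    (h2.comp_left (g := Complex.ofReal) rfl) (Complex.ofRealCLM.contDiff.comp h1)

theorem testFunction_apply {χ : ℝ → ℝ} (h1 : ContDiff ℝ ∞ χ) (h2 : HasCompactSupport χ) (x : ℝ) :
    testFunction h1 h2 x = (χ x : ℂ) := rfl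

theorem IsFunction.locallyIntegrable {S : 𝓢'(ℝ, ℂ)} {f : ℝ → ℂ} (hS : IsFunction S f) :
    LocallyIntegrable f := by
  intro x
  set b : ContDiffBump x := ⟨1, 2, one_pos, one_lt_two⟩
  refine ⟨Metric.closedBall x 1, Metric.closedBall_mem_nhds x one_pos, ?_⟩
  refine (hS (testFunction b.contDiff b.hasCompactSupport)).1.integrableOn.congr_fun ?_
    Metric.isClosed_closedBall.measurableSet
  intro y hy
  have : b y = 1 := b.one_of_mem_closedBall hy
  simp [testFunction_apply, this]

/-- The function that represents a distribution is unique almost everywhere. -/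
theorem IsFunction.ae_eq {S : 𝓢'(ℝ, ℂ)} {f g : ℝ → ℂ} (hf : IsFunction S f)
    (hg : IsFunction S g) : f =ᵐ[volume] g := by
  refine ae_eq_of_integral_contDiff_smul_eq hf.locallyIntegrable hg.locallyIntegrable
    fun χ h1 h2 => ?_
  have h := (hf (testFunction h1 h2)).2.symm.trans (hg (testFunction h1 h2)).2
  simpa [testFunction_apply] using h

/-! ### Sobolev spaces and the operator on the Fourier side -/

/-- The Bessel weight `(1 + ξ²)^(s/2)`. -/
noncomputable def besselWeight (s ξ : ℝ) : ℂ := ((1 + ‖ξ‖ ^ 2) ^ (s / 2) : ℝ)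

theorem hasTemperateGrowth_besselWeight (s : ℝ) : (besselWeight s).HasTemperateGrowth := by
  unfold besselWeight
  fun_prop

theorem besselWeight_neg_mul (s ξ : ℝ) : besselWeight (-s) ξ * besselWeight s ξ = 1 := by
  unfold besselWeight
  rw [← Complex.ofReal_mul, ← Real.rpow_add (by positivity)]
  ring_nf
  simp

/-- `J^s U = G` in terms of Fourier transforms. -/
theorem besselPotential_eq_iff (s : ℝ) (U : 𝓢'(ℝ, ℂ)) (G : Lp ℂ 2 (volume : Measure ℝ)) :
    besselPotential ℝ ℂ s U = (G : 𝓢'(ℝ, ℂ)) ↔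
      IsFunction (𝓕 U) (fun ξ => besselWeight (-s) ξ * (𝓕 G : Lp ℂ 2 (volume : Measure ℝ)) ξ) := by
  have hG := isTempered_of_memLp_two (Lp.memLp (𝓕 G : Lp ℂ 2 (volume : Measure ℝ)))
  have hsm : 𝓕 (besselPotential ℝ ℂ s U) = smulLeftCLM ℂ (besselWeight s) (𝓕 U) :=
    fourier_besselPotential_eq_smulLeftCLM_fourier_apply s U
  constructor
  · intro h φ
    refine ⟨(hG.mul_left_of_hasTemperateGrowth
      (hasTemperateGrowth_besselWeight (-s))).integrable_mul φ, ?_⟩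
    have h1 : smulLeftCLM ℂ (besselWeight s) (𝓕 U)
        = ((𝓕 G : Lp ℂ 2 (volume : Measure ℝ)) : 𝓢'(ℝ, ℂ)) := by
      rw [← hsm, h, Lp.fourier_toTemperedDistribution_eq]
    -- `φ` is divided by the weight, so that the weight can be moved to the distribution.
    have h2 : φ = SchwartzMap.smulLeftCLM ℂ (besselWeight s)
        (SchwartzMap.smulLeftCLM ℂ (besselWeight (-s)) φ) := by
      ext ξ
      rw [SchwartzMap.smulLeftCLM_apply_apply (hasTemperateGrowth_besselWeight _),
        SchwartzMap.smulLeftCLM_apply_apply (hasTemperateGrowth_besselWeight _), smul_smul,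
        mul_comm, besselWeight_neg_mul, one_smul]
    conv_lhs => rw [h2]
    rw [← smulLeftCLM_apply_apply, h1, Lp.toTemperedDistribution_apply]
    refine integral_congr_ae (Filter.Eventually.of_forall fun ξ => ?_)
    simp only [SchwartzMap.smulLeftCLM_apply_apply (hasTemperateGrowth_besselWeight _),
      smul_eq_mul]
    ring
  · intro h
    suffices h3 : 𝓕 (besselPotential ℝ ℂ s U) = 𝓕 (G : 𝓢'(ℝ, ℂ)) by
      have h4 := congrArg (fun T : 𝓢'(ℝ, ℂ) => (𝓕⁻ T : 𝓢'(ℝ, ℂ))) h3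
      simpa only [fourierInv_fourier_eq] using h4
    rw [hsm, Lp.fourier_toTemperedDistribution_eq]
    ext φ
    rw [smulLeftCLM_apply_apply, (h _).2, Lp.toTemperedDistribution_apply]
    refine integral_congr_ae (Filter.Eventually.of_forall fun ξ => ?_)
    simp only [SchwartzMap.smulLeftCLM_apply_apply (hasTemperateGrowth_besselWeight _),
      smul_eq_mul]
    linear_combination (φ ξ * (𝓕 G : Lp ℂ 2 (volume : Measure ℝ)) ξ) * besselWeight_neg_mul s ξ

theorem exists_isFunction_fourier_of_memSobolev {s : ℝ} {w : 𝓢'(ℝ, ℂ)} (hw : MemSobolev s 2 w) :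
    ∃ a : Lp ℂ 2 (volume : Measure ℝ), IsFunction (𝓕 w) fun ξ => besselWeight (-s) ξ * a ξ := by
  obtain ⟨G, hG⟩ := hw
  exact ⟨_, (besselPotential_eq_iff s w G).1 hG⟩

/-- The frequency `h_α` in Mathlib's normalization of the Fourier variable. -/
noncomputable def angFreq (α ξ : ℝ) : ℝ := freq α (2 * Real.pi * ξ)

theorem measurable_angFreq (α : ℝ) : Measurable (angFreq α) := by
  have := measurable_freq α
  unfold angFreq
  fun_prop

theorem fourier_derivCLM_derivCLM_apply (w : 𝓢'(ℝ, ℂ)) (φ : 𝓢(ℝ, ℂ)) :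
    𝓕 (derivCLM ℂ (derivCLM ℂ w)) φ
      = 𝓕 w (SchwartzMap.smulLeftCLM ℂ (fun ξ : ℝ => -((2 * Real.pi * ξ : ℝ) : ℂ) ^ 2) φ) := by
  have hd : ∀ ψ : 𝓢(ℝ, ℂ), SchwartzMap.derivCLM ℂ ℂ ψ = ∂_{(1 : ℝ)} ψ := fun ψ => by
    ext x
    rw [SchwartzMap.derivCLM_apply, SchwartzMap.lineDerivOp_apply_eq_fderiv,
      fderiv_apply_one_eq_deriv]
  rw [TemperedDistribution.fourier_apply, TemperedDistribution.fourier_apply,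
    derivCLM_apply_apply, derivCLM_apply_apply, map_neg, map_neg, map_neg, neg_neg, hd, hd,
    SchwartzMap.lineDerivOp_fourier_eq, SchwartzMap.lineDerivOp_fourier_eq]
  congr 2
  ext ξ
  have h1 : (fun x : ℝ => inner ℝ x (1 : ℝ)).HasTemperateGrowth := by fun_prop
  have h2 : (fun ξ : ℝ => -((2 * Real.pi * ξ : ℝ) : ℂ) ^ 2).HasTemperateGrowth := by fun_prop
  simp only [SchwartzMap.smulLeftCLM_apply_apply h1, SchwartzMap.smulLeftCLM_apply_apply h2,
    smul_apply, smul_eq_mul, Complex.real_smul]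
  simp only [RCLike.inner_apply, conj_trivial, one_mul]
  push_cast
  linear_combination (4 * Real.pi ^ 2 * ξ ^ 2 * φ ξ) * Complex.I_sq

theorem isFunction_fourier_derivCLM_derivCLM {w : 𝓢'(ℝ, ℂ)} {g : ℝ → ℂ}
    (hw : IsFunction (𝓕 w) g) : IsFunction (𝓕 (derivCLM ℂ (derivCLM ℂ w)))
      fun ξ => -((2 * Real.pi * ξ : ℝ) : ℂ) ^ 2 * g ξ := fun φ => by
  have ht : (fun ξ : ℝ => -((2 * Real.pi * ξ : ℝ) : ℂ) ^ 2).HasTemperateGrowth := by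
    fun_prop
  have h := hw (SchwartzMap.smulLeftCLM ℂ (fun ξ : ℝ => -((2 * Real.pi * ξ : ℝ) : ℂ) ^ 2) φ)
  rw [fourier_derivCLM_derivCLM_apply]
  simp only [SchwartzMap.smulLeftCLM_apply_apply ht, smul_eq_mul] at h
  have he : ∀ ξ : ℝ, φ ξ * (-((2 * Real.pi * ξ : ℝ) : ℂ) ^ 2 * g ξ)
      = -((2 * Real.pi * ξ : ℝ) : ℂ) ^ 2 * φ ξ * g ξ := fun ξ => by ring
  simp only [he]
  exact h

theorem isFunction_fourier_kernelL {α : ℝ} (hα : α ∈ Set.Ioo (1 : ℝ) 3) :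
    IsFunction (𝓕 (kernelL α)) fun ξ => (symbolL α (2 * Real.pi * ξ) : ℂ) := by
  rw [kernelL, fourier_fourierInv_eq]
  exact isFunction_ofBounded (memLp_symbolL hα)

theorem freq_sq {α : ℝ} (hα : α ∈ Set.Ioo (1 : ℝ) 3) (η : ℝ) :
    freq α η ^ 2 = symbolL α η * η ^ 2 := by
  have ha := aConst_pos hα
  have : 0 ≤ aConst α * |η| ^ α := by positivity
  rw [freq, symbolL, div_pow, Real.sq_sqrt (by linarith), sq_abs]
  ring

theorem symbolL_mul_neg_sq {α : ℝ} (hα : α ∈ Set.Ioo (1 : ℝ) 3) (ξ : ℝ) (z : ℂ) :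
    (symbolL α (2 * Real.pi * ξ) : ℂ) * (-((2 * Real.pi * ξ : ℝ) : ℂ) ^ 2 * z)
      = -(angFreq α ξ : ℂ) ^ 2 * z := by
  have h := freq_sq hα (2 * Real.pi * ξ)
  rw [angFreq, ← Complex.ofReal_pow (freq _ _), h]
  push_cast
  ring

/-- `L^α_x ∂_x²` is the Fourier multiplier with symbol `-h_α²`. -/
theorem IsLapEringen.isFunction_fourier {α : ℝ} (hα : α ∈ Set.Ioo (1 : ℝ) 3) {w z : 𝓢'(ℝ, ℂ)}
    (h : IsLapEringen α w z) {g : ℝ → ℂ} (hw : IsFunction (𝓕 w) g) :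
    IsFunction (𝓕 z) fun ξ => -(angFreq α ξ : ℂ) ^ 2 * g ξ := by
  obtain ⟨f, k, hf, hk, hz⟩ := h
  refine hz.congr ?_
  filter_upwards [hf.ae_eq (isFunction_fourier_kernelL hα),
    hk.ae_eq (isFunction_fourier_derivCLM_derivCLM hw)] with ξ h1 h2
  rw [h1, h2, symbolL_mul_neg_sq hα]

theorem isLapEringen_of_isFunction {α : ℝ} (hα : α ∈ Set.Ioo (1 : ℝ) 3) {w z : 𝓢'(ℝ, ℂ)}
    {g : ℝ → ℂ} (hw : IsFunction (𝓕 w) g)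
    (hz : IsFunction (𝓕 z) fun ξ => -(angFreq α ξ : ℂ) ^ 2 * g ξ) : IsLapEringen α w z := by
  refine ⟨_, _, isFunction_fourier_kernelL hα, isFunction_fourier_derivCLM_derivCLM hw,
    hz.congr (Filter.Eventually.of_forall fun ξ => ?_)⟩
  exact (symbolL_mul_neg_sq hα ξ (g ξ)).symm

theorem angFreq_nonneg (α ξ : ℝ) : 0 ≤ angFreq α ξ := by
  unfold angFreq freq
  positivity

theorem angFreq_le {α : ℝ} (hα : α ∈ Set.Ioo (1 : ℝ) 3) (ξ : ℝ) :
    angFreq α ξ ≤ 2 * Real.pi * (1 + |ξ|) := by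
  have ha := aConst_pos hα
  have hp : 0 ≤ aConst α * |2 * Real.pi * ξ| ^ α := by positivity
  have h1 : freq α (2 * Real.pi * ξ) ≤ |2 * Real.pi * ξ| := by
    refine div_le_self (abs_nonneg _) ?_
    rw [Real.one_le_sqrt]
    linarith
  rw [abs_mul, abs_of_pos Real.two_pi_pos] at h1
  refine h1.trans ?_
  have := Real.two_pi_pos
  nlinarith

theorem angFreq_pos {α : ℝ} (hα : α ∈ Set.Ioo (1 : ℝ) 3) {ξ : ℝ} (hξ : ξ ≠ 0) :
    0 < angFreq α ξ := by
  have ha := aConst_pos hα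
  have : 0 ≤ aConst α * |2 * Real.pi * ξ| ^ α := by positivity
  have hpi := Real.pi_pos
  refine div_pos (by positivity) (Real.sqrt_pos.2 (by linarith))

theorem IsTempered.neg_angFreq_sq_mul {α : ℝ} (hα : α ∈ Set.Ioo (1 : ℝ) 3) {g : ℝ → ℂ}
    (hg : IsTempered g) : IsTempered fun ξ => -(angFreq α ξ : ℂ) ^ 2 * g ξ := by
  have hm := measurable_angFreq α
  refine hg.mul_left (Measurable.aestronglyMeasurable (by fun_prop))
    ⟨(2 * Real.pi) ^ 2, 2, fun ξ => ?_⟩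
  rw [norm_neg, norm_pow, Complex.norm_real, Real.norm_of_nonneg (angFreq_nonneg α ξ), ← mul_pow]
  exact pow_le_pow_left₀ (angFreq_nonneg α ξ) (angFreq_le hα ξ) 2

/-! ### The partial inverse Fourier transform of a space-time test function -/

theorem norm_iteratedFDeriv_slice_le (Φ : 𝓢(ℝ × ℝ, ℂ)) (t x : ℝ) (n : ℕ) :
    ‖iteratedFDeriv ℝ n (slice t Φ) x‖ ≤ ‖iteratedFDeriv ℝ n Φ (x, t)‖ := by
  have h1 : (slice t Φ : ℝ → ℂ)
      = (fun y : ℝ × ℝ => Φ (y + (0, t))) ∘ ContinuousLinearMap.inl ℝ ℝ ℝ := by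
    ext y
    simp
  have hs : ContDiff ℝ n (fun y : ℝ × ℝ => Φ (y + (0, t))) :=
    (Φ.smooth n).comp (contDiff_id.add contDiff_const)
  rw [h1, (ContinuousLinearMap.inl ℝ ℝ ℝ).iteratedFDeriv_comp_right hs x le_rfl,
    iteratedFDeriv_comp_add_right]
  refine (ContinuousMultilinearMap.norm_compContinuousLinearMap_le _ _).trans ?_
  have h2 : (∏ _i : Fin n, ‖ContinuousLinearMap.inl ℝ ℝ ℝ‖) ≤ 1 :=
    Finset.prod_le_one (fun _ _ => norm_nonneg _)
      fun _ _ => ContinuousLinearMap.norm_inl_le_one ℝ ℝ ℝ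
  simpa using mul_le_of_le_one_right (norm_nonneg _) h2

theorem one_add_abs_pow_mul_seminorm_slice_le (k n M : ℕ) (Φ : 𝓢(ℝ × ℝ, ℂ)) (t : ℝ) :
    (1 + |t|) ^ M * SchwartzMap.seminorm ℂ k n (slice t Φ)
      ≤ 2 ^ (k + M) * (Finset.Iic (k + M, n)).sup (schwartzSeminormFamily ℂ (ℝ × ℝ) ℂ) Φ := by
  have h0 : (0 : ℝ) < (1 + |t|) ^ M := by positivity
  rw [mul_comm, ← le_div_iff₀ h0]
  refine SchwartzMap.seminorm_le_bound ℂ k n _ (by positivity) fun x => ?_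
  rw [le_div_iff₀ h0]
  have h1 := SchwartzMap.one_add_le_sup_seminorm_apply (𝕜 := ℂ) (m := (k + M, n)) (k := k + M)
    (n := n) le_rfl le_rfl Φ (x, t)
  refine le_trans ?_ h1
  have hx : |x| ≤ 1 + ‖(x, t)‖ := by
    have := norm_fst_le (x, t)
    rw [Real.norm_eq_abs] at this
    linarith
  have ht : 1 + |t| ≤ 1 + ‖(x, t)‖ := by
    have := norm_snd_le (x, t)
    rw [Real.norm_eq_abs] at this
    linarith
  have h2 := norm_iteratedFDeriv_slice_le Φ t x n
  rw [Real.norm_eq_abs, pow_add]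
  calc |x| ^ k * ‖iteratedFDeriv ℝ n (slice t Φ) x‖ * (1 + |t|) ^ M
      ≤ (1 + ‖(x, t)‖) ^ k * ‖iteratedFDeriv ℝ n Φ (x, t)‖ * (1 + ‖(x, t)‖) ^ M := by gcongr
    _ = _ := by ring

/-- Continuity of the inverse Fourier transform on Schwartz functions, in terms of seminorms. -/
theorem exists_bound_fourierInv (N : ℕ) : ∃ (s : Finset (ℕ × ℕ)) (C : ℝ), 0 ≤ C ∧
    ∀ (φ : 𝓢(ℝ, ℂ)) (ξ : ℝ), (1 + |ξ|) ^ N * ‖(𝓕⁻ φ : 𝓢(ℝ, ℂ)) ξ‖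
      ≤ C * s.sup (schwartzSeminormFamily ℂ ℝ ℂ) φ := by
  have hS := schwartz_withSeminorms ℂ ℝ ℂ
  set q : Seminorm ℂ 𝓢(ℝ, ℂ) := ((Finset.Iic (N, 0)).sup (schwartzSeminormFamily ℂ ℝ ℂ)).comp
    (fourierInvCLM ℂ 𝓢(ℝ, ℂ) : 𝓢(ℝ, ℂ) →ₗ[ℂ] 𝓢(ℝ, ℂ))
  have hq : Continuous q := by
    have h1 := Seminorm.continuous_finsetSup (s := Finset.Iic (N, 0))
      fun i _ => hS.continuous_seminorm i
    exact h1.comp (fourierInvCLM ℂ 𝓢(ℝ, ℂ)).continuous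
  obtain ⟨s, C, -, hC⟩ := Seminorm.bound_of_continuous hS q hq
  refine ⟨s, 2 ^ N * C, by positivity, fun φ ξ => ?_⟩
  refine (one_add_abs_pow_mul_le N (𝓕⁻ φ) ξ).trans ?_
  rw [mul_assoc]
  exact mul_le_mul_of_nonneg_left (hC φ) (by positivity)

/-- The partial inverse Fourier transform of a Schwartz function decays rapidly in both variables, with
constants given by Schwartz seminorms. -/
theorem exists_bound_fourierInv_slice (N M : ℕ) : ∃ (s : Finset (ℕ × ℕ)) (C : ℝ), 0 ≤ C ∧
    ∀ (Φ : 𝓢(ℝ × ℝ, ℂ)) (t ξ : ℝ),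
      (1 + |t|) ^ M * ((1 + |ξ|) ^ N * ‖(𝓕⁻ (slice t Φ) : 𝓢(ℝ, ℂ)) ξ‖)
        ≤ C * s.sup (schwartzSeminormFamily ℂ (ℝ × ℝ) ℂ) Φ := by
  obtain ⟨s, C, hC0, hC⟩ := exists_bound_fourierInv N
  set K := s.sup Prod.fst
  set n := s.sup Prod.snd
  refine ⟨Finset.Iic (K + M, n), C * 2 ^ (K + M), by positivity, fun Φ t ξ => ?_⟩
  have h0 : (0 : ℝ) < (1 + |t|) ^ M := by positivity
  have h1 : s.sup (schwartzSeminormFamily ℂ ℝ ℂ) (slice t Φ)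
      ≤ 2 ^ (K + M) * (Finset.Iic (K + M, n)).sup (schwartzSeminormFamily ℂ (ℝ × ℝ) ℂ) Φ
        / (1 + |t|) ^ M := by
    refine Seminorm.finset_sup_apply_le (by positivity) fun i hi => ?_
    rw [le_div_iff₀ h0, mul_comm]
    refine (one_add_abs_pow_mul_seminorm_slice_le i.1 i.2 M Φ t).trans ?_
    have hiK : i.1 ≤ K := Finset.le_sup (f := Prod.fst) hi
    have hin : i.2 ≤ n := Finset.le_sup (f := Prod.snd) hi
    gcongr
    · exact one_le_two
    · refine Seminorm.le_def.1 (Finset.sup_mono ?_) Φ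
      exact Finset.Iic_subset_Iic.2 (Prod.mk_le_mk.2 ⟨by omega, hin⟩)
  rw [le_div_iff₀ h0] at h1
  calc (1 + |t|) ^ M * ((1 + |ξ|) ^ N * ‖(𝓕⁻ (slice t Φ) : 𝓢(ℝ, ℂ)) ξ‖)
      ≤ (1 + |t|) ^ M * (C * s.sup (schwartzSeminormFamily ℂ ℝ ℂ) (slice t Φ)) := by
        exact mul_le_mul_of_nonneg_left (hC _ ξ) h0.le
    _ = C * (s.sup (schwartzSeminormFamily ℂ ℝ ℂ) (slice t Φ) * (1 + |t|) ^ M) := by ring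
    _ ≤ _ := by
      rw [mul_assoc C]
      exact mul_le_mul_of_nonneg_left h1 hC0

theorem hasDerivAt_slice_apply (Φ : 𝓢(ℝ × ℝ, ℂ)) (t x : ℝ) :
    HasDerivAt (fun r => Φ (x, r)) (∂_{((0, 1) : ℝ × ℝ)} Φ (x, t)) t := by
  rw [SchwartzMap.lineDerivOp_apply_eq_fderiv]
  exact (Φ.hasFDerivAt (x, t)).comp_hasDerivAt t ((hasDerivAt_const t x).prodMk (hasDerivAt_id t))

theorem hasDerivAt_fourierInv_slice (Φ : 𝓢(ℝ × ℝ, ℂ)) (t ξ : ℝ) :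
    HasDerivAt (fun r => (𝓕⁻ (slice r Φ) : 𝓢(ℝ, ℂ)) ξ)
      ((𝓕⁻ (slice t (∂_{((0, 1) : ℝ × ℝ)} Φ)) : 𝓢(ℝ, ℂ)) ξ) t := by
  have hF : ∀ (Ψ : 𝓢(ℝ × ℝ, ℂ)) (r : ℝ), (𝓕⁻ (slice r Ψ) : 𝓢(ℝ, ℂ)) ξ
      = ∫ x, Real.fourierChar (inner ℝ x ξ) • Ψ (x, r) := fun Ψ r => by
    rw [SchwartzMap.fourierInv_coe, Real.fourierInv_eq]
    rfl
  set Φ' := ∂_{((0, 1) : ℝ × ℝ)} Φ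
  simp only [hF]
  have hcont : ∀ (Ψ : 𝓢(ℝ × ℝ, ℂ)) (r : ℝ),
      Continuous fun x : ℝ => Real.fourierChar (inner ℝ x ξ) • Ψ (x, r) := fun Ψ r => by
    have := Ψ.continuous
    fun_prop
  have hb : ∀ (Ψ : 𝓢(ℝ × ℝ, ℂ)), ∃ C : ℝ, ∀ x r : ℝ,
      ‖Real.fourierChar (inner ℝ x ξ) • Ψ (x, r)‖ ≤ C * (1 + ‖x‖) ^ (-2 : ℝ) := fun Ψ => by
    refine ⟨2 ^ 2 * (Finset.Iic (2, 0)).sup (fun m => SchwartzMap.seminorm ℂ m.1 m.2) Ψ,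
      fun x r => ?_⟩
    have h1 := SchwartzMap.one_add_le_sup_seminorm_apply (𝕜 := ℂ) (m := (2, 0)) (k := 2)
      (n := 0) le_rfl le_rfl Ψ (x, r)
    rw [norm_iteratedFDeriv_zero] at h1
    have h2 : ‖x‖ ≤ ‖(x, r)‖ := norm_fst_le (x, r)
    rw [Circle.norm_smul, Real.rpow_neg (by positivity), ← div_eq_mul_inv,
      le_div_iff₀ (by positivity)]
    refine le_trans ?_ h1
    norm_cast
    rw [mul_comm]
    gcongr
  have hint : Integrable fun x : ℝ => (1 + ‖x‖) ^ (-2 : ℝ) :=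
    integrable_one_add_norm (by simp)
  obtain ⟨C, hC⟩ := hb Φ
  obtain ⟨C', hC'⟩ := hb Φ'
  refine (hasDerivAt_integral_of_dominated_loc_of_deriv_le
    (F := fun r x => Real.fourierChar (inner ℝ x ξ) • Φ (x, r))
    (F' := fun r x => Real.fourierChar (inner ℝ x ξ) • Φ' (x, r))
    (bound := fun x => C' * (1 + ‖x‖) ^ (-2 : ℝ)) Filter.univ_mem
    (Filter.Eventually.of_forall fun r => (hcont Φ r).aestronglyMeasurable)
    ((hint.const_mul C).mono' (hcont Φ t).aestronglyMeasurable
      (Filter.Eventually.of_forall fun x => hC x t))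
    (hcont Φ' t).aestronglyMeasurable
    (Filter.Eventually.of_forall fun x r _ => hC' x r) (hint.const_mul C')
    (Filter.Eventually.of_forall fun x r _ => ?_)).2
  exact (hasDerivAt_slice_apply Φ r x).const_smul (Real.fourierChar (inner ℝ x ξ))

/-! ### The wave family and its pairings -/

/-- The solution of `y'' + h_α(ξ)² y = 0` with `y(0) = g₀(ξ)` and `y'(0) = g₁(ξ)`, for all `ξ ≠ 0`.
At `ξ = 0` the quotient is `0 / 0 = 0`, which is harmless as `ξ = 0` is a null set. -/
noncomputable def wave (α : ℝ) (g₀ g₁ : ℝ → ℂ) (t ξ : ℝ) : ℂ :=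
  (Real.cos (angFreq α ξ * t) : ℂ) * g₀ ξ
    + ((Real.sin (angFreq α ξ * t) / angFreq α ξ : ℝ) : ℂ) * g₁ ξ

/-- The symbol `-h_α²` applied to `g`. -/
noncomputable def lapMul (α : ℝ) (g : ℝ → ℂ) (ξ : ℝ) : ℂ := -(angFreq α ξ : ℂ) ^ 2 * g ξ

theorem IsTempered.lapMul {α : ℝ} (hα : α ∈ Set.Ioo (1 : ℝ) 3) {g : ℝ → ℂ} (hg : IsTempered g) :
    IsTempered (lapMul α g) :=
  hg.neg_angFreq_sq_mul hα

theorem wave_zero (α : ℝ) (g₀ g₁ : ℝ → ℂ) (ξ : ℝ) : wave α g₀ g₁ 0 ξ = g₀ ξ := by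
  simp [wave]

theorem wave_lapMul (α : ℝ) (g₀ g₁ : ℝ → ℂ) (t ξ : ℝ) :
    wave α (lapMul α g₀) (lapMul α g₁) t ξ = -(angFreq α ξ : ℂ) ^ 2 * wave α g₀ g₁ t ξ := by
  unfold wave lapMul
  ring

/-- The time derivative of a wave is the wave with data `(g₁, -h_α² g₀)`; so all time derivatives are
waves again. The frequency `ξ = 0` is excluded because of the value `0 / 0 = 0` there. -/
theorem hasDerivAt_wave {α : ℝ} (hα : α ∈ Set.Ioo (1 : ℝ) 3) (g₀ g₁ : ℝ → ℂ) {ξ : ℝ} (hξ : ξ ≠ 0)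
    (t : ℝ) : HasDerivAt (fun r => wave α g₀ g₁ r ξ) (wave α g₁ (lapMul α g₀) t ξ) t := by
  have hw := (angFreq_pos hα hξ).ne'
  set w := angFreq α ξ with hwd
  have h1 : HasDerivAt (fun r : ℝ => w * r) w t := by
    simpa using (hasDerivAt_id t).const_mul w
  have hc := (h1.cos.ofReal_comp).mul_const (g₀ ξ)
  have hs := ((h1.sin.div_const w).ofReal_comp).mul_const (g₁ ξ)
  refine (hc.add hs).congr_deriv ?_
  have hw' : (w : ℂ) ≠ 0 := by exact_mod_cast hw
  simp only [wave, lapMul, ← hwd]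
  push_cast
  field_simp
  ring

theorem abs_sin_div_le (t w : ℝ) : |Real.sin (w * t) / w| ≤ |t| := by
  rw [abs_div]
  refine div_le_of_le_mul₀ (abs_nonneg _) (abs_nonneg _) ?_
  calc |Real.sin (w * t)| ≤ |w * t| := Real.abs_sin_le_abs
    _ = |t| * |w| := by rw [abs_mul, mul_comm]

theorem norm_wave_le (α : ℝ) (g₀ g₁ : ℝ → ℂ) (t ξ : ℝ) :
    ‖wave α g₀ g₁ t ξ‖ ≤ (1 + |t|) * (‖g₀ ξ‖ + ‖g₁ ξ‖) := by
  have h1 : ‖(Real.cos (angFreq α ξ * t) : ℂ) * g₀ ξ‖ ≤ 1 * ‖g₀ ξ‖ := by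
    rw [norm_mul, Complex.norm_real, Real.norm_eq_abs]
    gcongr
    exact Real.abs_cos_le_one _
  have h2 : ‖((Real.sin (angFreq α ξ * t) / angFreq α ξ : ℝ) : ℂ) * g₁ ξ‖ ≤ |t| * ‖g₁ ξ‖ := by
    rw [norm_mul, Complex.norm_real, Real.norm_eq_abs]
    exact mul_le_mul_of_nonneg_right (abs_sin_div_le t _) (norm_nonneg _)
  have h3 := norm_add_le ((Real.cos (angFreq α ξ * t) : ℂ) * g₀ ξ)
    (((Real.sin (angFreq α ξ * t) / angFreq α ξ : ℝ) : ℂ) * g₁ ξ)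
  rw [wave]
  have h4 := mul_nonneg (abs_nonneg t) (norm_nonneg (g₀ ξ))
  have h5 := norm_nonneg (g₁ ξ)
  nlinarith

theorem aestronglyMeasurable_wave (α : ℝ) {g₀ g₁ : ℝ → ℂ} (h₀ : AEStronglyMeasurable g₀)
    (h₁ : AEStronglyMeasurable g₁) (t : ℝ) : AEStronglyMeasurable (wave α g₀ g₁ t) := by
  have hm := measurable_angFreq α
  refine AEStronglyMeasurable.add (AEStronglyMeasurable.mul ?_ h₀)
    (AEStronglyMeasurable.mul ?_ h₁)
  · exact Measurable.aestronglyMeasurable (by fun_prop)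
  · exact Measurable.aestronglyMeasurable (by fun_prop)

/-- A common bound for two tempered functions, stated as a complex function. -/
theorem IsTempered.norm_add_norm {g₀ g₁ : ℝ → ℂ} (h₀ : IsTempered g₀) (h₁ : IsTempered g₁) :
    IsTempered fun ξ => ((‖g₀ ξ‖ + ‖g₁ ξ‖ : ℝ) : ℂ) := by
  have hn : ∀ {g : ℝ → ℂ}, IsTempered g → IsTempered fun ξ => ((‖g ξ‖ : ℝ) : ℂ) := fun {g} hg =>
    IsTempered.of_norm_le (Complex.continuous_ofReal.comp_aestronglyMeasurable hg.1.norm) hg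
      fun ξ => by simp
  simpa using (hn h₀).add (hn h₁)

theorem isTempered_wave (α : ℝ) {g₀ g₁ : ℝ → ℂ} (h₀ : IsTempered g₀) (h₁ : IsTempered g₁)
    (t : ℝ) : IsTempered (wave α g₀ g₁ t) := by
  refine IsTempered.of_norm_le (aestronglyMeasurable_wave α h₀.1 h₁.1 t)
    ((h₀.norm_add_norm h₁).mul_left (m := fun _ => ((1 + |t| : ℝ) : ℂ))
      aestronglyMeasurable_const ⟨1 + |t|, 0, fun ξ => ?_⟩) fun ξ => ?_
  · rw [Complex.norm_real, Real.norm_of_nonneg (by positivity)]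
    simp
  · rw [norm_mul, Complex.norm_real, Complex.norm_real, Real.norm_of_nonneg (by positivity),
      Real.norm_of_nonneg (by positivity)]
    exact norm_wave_le α g₀ g₁ t ξ

/-- A time-dependent family of continuous functions that decay rapidly, uniformly in time. -/
structure IsTestFamily (ψ : ℝ → ℝ → ℂ) : Prop where
  continuous : ∀ t, Continuous (ψ t)
  bound : ∀ N : ℕ, ∃ C : ℝ, ∀ t ξ, (1 + |ξ|) ^ N * ‖ψ t ξ‖ ≤ C

/-- The partial inverse Fourier transform, in the space variable, of a space-time Schwartz function.
The inverse transform occurs because `⟨w, φ⟩ = ⟨𝓕 w, 𝓕⁻ φ⟩`. -/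
noncomputable def partialFourierInv (Φ : 𝓢(ℝ × ℝ, ℂ)) (t ξ : ℝ) : ℂ :=
  (𝓕⁻ (slice t Φ) : 𝓢(ℝ, ℂ)) ξ

theorem isTestFamily_const (φ : 𝓢(ℝ, ℂ)) : IsTestFamily fun _ => φ where
  continuous _ := φ.continuous
  bound N := ⟨_, fun _ => one_add_abs_pow_mul_le N φ⟩

theorem isTestFamily_zero : IsTestFamily fun _ _ => 0 where
  continuous _ := continuous_const
  bound _ := ⟨0, fun _ _ => by simp⟩

theorem isTestFamily_partialFourierInv (Φ : 𝓢(ℝ × ℝ, ℂ)) :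
    IsTestFamily (partialFourierInv Φ) where
  continuous t := (𝓕⁻ (slice t Φ) : 𝓢(ℝ, ℂ)).continuous
  bound N := by
    obtain ⟨s, C, -, hC⟩ := exists_bound_fourierInv_slice N 0
    refine ⟨C * s.sup (schwartzSeminormFamily ℂ (ℝ × ℝ) ℂ) Φ, fun t ξ => ?_⟩
    have := hC Φ t ξ
    rwa [pow_zero, one_mul] at this

/-- The pairing of the wave at time `t` with a test family at time `t`. -/
noncomputable def wavePairing (α : ℝ) (g₀ g₁ : ℝ → ℂ) (ψ : ℝ → ℝ → ℂ) (t : ℝ) : ℂ :=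
  ∫ ξ, ψ t ξ * wave α g₀ g₁ t ξ

theorem wavePairing_zero (α : ℝ) (g₀ g₁ : ℝ → ℂ) (ψ : ℝ → ℝ → ℂ) :
    wavePairing α g₀ g₁ ψ 0 = ∫ ξ, ψ 0 ξ * g₀ ξ := by
  simp only [wavePairing, wave_zero]

theorem IsTestFamily.integrable_mul {ψ : ℝ → ℝ → ℂ} (hψ : IsTestFamily ψ) {g : ℝ → ℂ}
    (hg : IsTempered g) (t : ℝ) : Integrable fun ξ => ψ t ξ * g ξ := by
  obtain ⟨hgm, N, hN⟩ := hg
  obtain ⟨C, hC⟩ := hψ.bound N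
  exact (integrable_mul_of_decay (hψ.continuous t).aestronglyMeasurable (hC t) hgm hN).1

/-- The integrable majorant, uniform for bounded times, for differentiation under the integral. -/
theorem exists_integrable_bound_mul_wave (α : ℝ) {g₀ g₁ : ℝ → ℂ} (h₀ : IsTempered g₀)
    (h₁ : IsTempered g₁) {ψ : ℝ → ℝ → ℂ} (hψ : IsTestFamily ψ) (T : ℝ) :
    ∃ b : ℝ → ℝ, Integrable b ∧ ∀ t, |t| ≤ T → ∀ ξ, ‖ψ t ξ * wave α g₀ g₁ t ξ‖ ≤ b ξ := by
  obtain ⟨-, N, hN⟩ := h₀.norm_add_norm h₁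
  obtain ⟨C, hC⟩ := hψ.bound N
  refine ⟨_, (hN.const_mul (C * (1 + T))), fun t ht ξ => ?_⟩
  have h0 : (0 : ℝ) < (1 + |ξ|) ^ N := by positivity
  have hC0 : 0 ≤ C := le_trans (by positivity) (hC t ξ)
  rw [norm_mul, Complex.norm_real, Real.norm_of_nonneg (by positivity)]
  calc ‖ψ t ξ‖ * ‖wave α g₀ g₁ t ξ‖
      ≤ ‖ψ t ξ‖ * ((1 + T) * (‖g₀ ξ‖ + ‖g₁ ξ‖)) := by
        gcongr
        exact (norm_wave_le α g₀ g₁ t ξ).trans (by gcongr)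
    _ = ((1 + |ξ|) ^ N * ‖ψ t ξ‖) * ((1 + T) * ((‖g₀ ξ‖ + ‖g₁ ξ‖) / (1 + |ξ|) ^ N)) := by
        field_simp
    _ ≤ C * ((1 + T) * ((‖g₀ ξ‖ + ‖g₁ ξ‖) / (1 + |ξ|) ^ N)) := by
        have hT : 0 ≤ T := (abs_nonneg t).trans ht
        gcongr
        exact hC t ξ
    _ = _ := by ring

theorem hasDerivAt_wavePairing {α : ℝ} (hα : α ∈ Set.Ioo (1 : ℝ) 3) {g₀ g₁ : ℝ → ℂ}
    (h₀ : IsTempered g₀) (h₁ : IsTempered g₁) {ψ ψ' : ℝ → ℝ → ℂ} (hψ : IsTestFamily ψ)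
    (hψ' : IsTestFamily ψ') (hd : ∀ t ξ, HasDerivAt (fun r => ψ r ξ) (ψ' t ξ) t) (t : ℝ) :
    HasDerivAt (wavePairing α g₀ g₁ ψ)
      (wavePairing α g₀ g₁ ψ' t + wavePairing α g₁ (lapMul α g₀) ψ t) t := by
  obtain ⟨b, hb, hb'⟩ := exists_integrable_bound_mul_wave α h₀ h₁ hψ' (|t| + 1)
  obtain ⟨c, hc, hc'⟩ :=
    exists_integrable_bound_mul_wave α h₁ (h₀.lapMul hα) hψ (|t| + 1)
  have hw := fun r => isTempered_wave α h₀ h₁ r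
  have hw' := fun r => isTempered_wave α h₁ (h₀.lapMul hα) r
  -- Dominated differentiation on the ball of radius `1` around `t`.
  have hball : ∀ r ∈ Metric.ball t 1, |r| ≤ |t| + 1 := fun r hr => by
    have h1 : |r - t| < 1 := by simpa [Real.dist_eq] using hr
    have h2 := abs_add_le (r - t) t
    rw [sub_add_cancel] at h2
    linarith
  have key := (hasDerivAt_integral_of_dominated_loc_of_deriv_le (μ := (volume : Measure ℝ))
    (F := fun r ξ => ψ r ξ * wave α g₀ g₁ r ξ) (x₀ := t) (s := Metric.ball t 1)
    (F' := fun r ξ => ψ' r ξ * wave α g₀ g₁ r ξ + ψ r ξ * wave α g₁ (lapMul α g₀) r ξ)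
    (bound := fun ξ => b ξ + c ξ) (Metric.ball_mem_nhds t one_pos)
    (Filter.Eventually.of_forall fun r => (hψ.integrable_mul (hw r) r).1)
    (hψ.integrable_mul (hw t) t)
    ((hψ'.integrable_mul (hw t) t).1.add (hψ.integrable_mul (hw' t) t).1)
    (Filter.Eventually.of_forall fun ξ r hr => (norm_add_le _ _).trans
      (add_le_add (hb' r (hball r hr) ξ) (hc' r (hball r hr) ξ)))
    (hb.add hc) ?_).2
  · refine key.congr_deriv ?_
    rw [integral_add (hψ'.integrable_mul (hw t) t) (hψ.integrable_mul (hw' t) t)]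
    rfl
  · filter_upwards [Measure.ae_ne volume (0 : ℝ)] with ξ hξ r _
    exact (hd r ξ).mul (hasDerivAt_wave hα g₀ g₁ hξ r)

theorem contDiff_wavePairing_const {α : ℝ} (hα : α ∈ Set.Ioo (1 : ℝ) 3) {g₀ g₁ : ℝ → ℂ}
    (h₀ : IsTempered g₀) (h₁ : IsTempered g₁) (φ : 𝓢(ℝ, ℂ)) :
    ContDiff ℝ ∞ (wavePairing α g₀ g₁ fun _ => φ) := by
  have hd : ∀ {g₀ g₁ : ℝ → ℂ}, IsTempered g₀ → IsTempered g₁ → ∀ t,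
      HasDerivAt (wavePairing α g₀ g₁ fun _ => φ)
        (wavePairing α g₁ (lapMul α g₀) (fun _ => φ) t) t := fun {g₀ g₁} h₀ h₁ t => by
    have := hasDerivAt_wavePairing hα h₀ h₁ (isTestFamily_const φ) isTestFamily_zero
      (fun t ξ => hasDerivAt_const t _) t
    simpa [wavePairing] using this
  refine contDiff_infty.2 fun n => ?_
  induction n generalizing g₀ g₁ with
  | zero =>
    exact contDiff_zero.2 (continuous_iff_continuousAt.2 fun t => (hd h₀ h₁ t).continuousAt)
  | succ n ih =>
    have hderiv : deriv (wavePairing α g₀ g₁ fun _ => φ)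
        = wavePairing α g₁ (lapMul α g₀) fun _ => φ := funext fun t => (hd h₀ h₁ t).deriv
    push_cast
    refine contDiff_succ_iff_deriv.2 ⟨fun t => (hd h₀ h₁ t).differentiableAt, by simp, ?_⟩
    rw [hderiv]
    exact ih h₁ (h₀.lapMul hα)

/-- The pairing with the wave is bounded by Schwartz seminorms and integrable in time. -/
theorem exists_bound_wavePairing (α : ℝ) {g₀ g₁ : ℝ → ℂ} (h₀ : IsTempered g₀)
    (h₁ : IsTempered g₁) : ∃ (s : Finset (ℕ × ℕ)) (C : ℝ), 0 ≤ C ∧ ∀ (Φ : 𝓢(ℝ × ℝ, ℂ)) (t : ℝ),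
      ‖wavePairing α g₀ g₁ (partialFourierInv Φ) t‖
        ≤ C * s.sup (schwartzSeminormFamily ℂ (ℝ × ℝ) ℂ) Φ * (1 + ‖t‖) ^ (-2 : ℝ) := by
  obtain ⟨-, N, hN⟩ := h₀.norm_add_norm h₁
  -- One of the three powers of `1 + |t|` absorbs the linear growth of the wave; two remain.
  obtain ⟨s, C, hC0, hC⟩ := exists_bound_fourierInv_slice N 3
  set I := ∫ ξ, ‖((‖g₀ ξ‖ + ‖g₁ ξ‖ : ℝ) : ℂ)‖ / (1 + |ξ|) ^ N
  have hI : 0 ≤ I := by positivity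
  refine ⟨s, C * I, by positivity, fun Φ t => ?_⟩
  set q := s.sup (schwartzSeminormFamily ℂ (ℝ × ℝ) ℂ) Φ
  have hq : 0 ≤ q := by positivity
  have h0 : (0 : ℝ) < 1 + |t| := by positivity
  have hb : ∀ ξ, ‖partialFourierInv Φ t ξ * wave α g₀ g₁ t ξ‖
      ≤ C * q * (1 + ‖t‖) ^ (-2 : ℝ)
        * (‖((‖g₀ ξ‖ + ‖g₁ ξ‖ : ℝ) : ℂ)‖ / (1 + |ξ|) ^ N) := fun ξ => by
    have hξ : (0 : ℝ) < (1 + |ξ|) ^ N := by positivity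
    have h1 := hC Φ t ξ
    have h2 := norm_wave_le α g₀ g₁ t ξ
    have h3 : (0 : ℝ) ≤ ‖g₀ ξ‖ + ‖g₁ ξ‖ := by positivity
    have h4 : (1 + ‖t‖) ^ (-2 : ℝ) = ((1 + |t|) ^ 2)⁻¹ := by
      rw [Real.norm_eq_abs, Real.rpow_neg h0.le]
      norm_cast
    rw [norm_mul, Complex.norm_real, Real.norm_of_nonneg h3, h4]
    calc ‖partialFourierInv Φ t ξ‖ * ‖wave α g₀ g₁ t ξ‖
        ≤ ‖partialFourierInv Φ t ξ‖ * ((1 + |t|) * (‖g₀ ξ‖ + ‖g₁ ξ‖)) := by gcongr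
      _ = ((1 + |t|) ^ 3 * ((1 + |ξ|) ^ N * ‖partialFourierInv Φ t ξ‖))
          * (((1 + |t|) ^ 2)⁻¹ * ((‖g₀ ξ‖ + ‖g₁ ξ‖) / (1 + |ξ|) ^ N)) := by field_simp
      _ ≤ (C * q) * (((1 + |t|) ^ 2)⁻¹ * ((‖g₀ ξ‖ + ‖g₁ ξ‖) / (1 + |ξ|) ^ N)) :=
        mul_le_mul_of_nonneg_right h1 (by positivity)
      _ = _ := by ring
  refine (norm_integral_le_of_norm_le (hN.const_mul _) (Filter.Eventually.of_forall hb)).trans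
    (le_of_eq ?_)
  rw [integral_const_mul]
  ring

theorem hasDerivAt_wavePairing_partialFourierInv {α : ℝ} (hα : α ∈ Set.Ioo (1 : ℝ) 3)
    {g₀ g₁ : ℝ → ℂ} (h₀ : IsTempered g₀) (h₁ : IsTempered g₁) (Φ : 𝓢(ℝ × ℝ, ℂ)) (t : ℝ) :
    HasDerivAt (wavePairing α g₀ g₁ (partialFourierInv Φ))
      (wavePairing α g₀ g₁ (partialFourierInv (∂_{((0, 1) : ℝ × ℝ)} Φ)) t
        + wavePairing α g₁ (lapMul α g₀) (partialFourierInv Φ) t) t :=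
  hasDerivAt_wavePairing hα h₀ h₁ (isTestFamily_partialFourierInv _)
    (isTestFamily_partialFourierInv _) (fun t ξ => hasDerivAt_fourierInv_slice Φ t ξ) t

theorem integrable_wavePairing {α : ℝ} (hα : α ∈ Set.Ioo (1 : ℝ) 3) {g₀ g₁ : ℝ → ℂ}
    (h₀ : IsTempered g₀) (h₁ : IsTempered g₁) (Φ : 𝓢(ℝ × ℝ, ℂ)) :
    Integrable (wavePairing α g₀ g₁ (partialFourierInv Φ)) := by
  obtain ⟨s, C, -, hC⟩ := exists_bound_wavePairing α h₀ h₁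
  have hint : Integrable fun t : ℝ => (1 + ‖t‖) ^ (-2 : ℝ) := integrable_one_add_norm (by simp)
  refine (hint.const_mul _).mono' (Continuous.aestronglyMeasurable ?_)
    (Filter.Eventually.of_forall (hC Φ))
  exact continuous_iff_continuousAt.2 fun t =>
    (hasDerivAt_wavePairing_partialFourierInv hα h₀ h₁ Φ t).continuousAt

theorem tendsto_wavePairing_atTop (α : ℝ) {g₀ g₁ : ℝ → ℂ} (h₀ : IsTempered g₀)
    (h₁ : IsTempered g₁) (Φ : 𝓢(ℝ × ℝ, ℂ)) :
    Filter.Tendsto (wavePairing α g₀ g₁ (partialFourierInv Φ)) Filter.atTop (nhds 0) := by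
  obtain ⟨s, C, -, hC⟩ := exists_bound_wavePairing α h₀ h₁
  refine squeeze_zero_norm (hC Φ) ?_
  have h1 : Filter.Tendsto (fun t : ℝ => 1 + ‖t‖) Filter.atTop Filter.atTop :=
    Filter.tendsto_atTop_add_const_left _ _ tendsto_norm_atTop_atTop
  have h2 := ((tendsto_rpow_neg_atTop (y := 2) two_pos).comp h1).const_mul
    (C * s.sup (schwartzSeminormFamily ℂ (ℝ × ℝ) ℂ) Φ)
  simpa using h2

/-- Two integrations by parts in time; the boundary terms at `t = 0` produce the initial data. -/
theorem integral_wavePairing_dt_dt {α : ℝ} (hα : α ∈ Set.Ioo (1 : ℝ) 3) {g₀ g₁ : ℝ → ℂ}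
    (h₀ : IsTempered g₀) (h₁ : IsTempered g₁) (Φ : 𝓢(ℝ × ℝ, ℂ)) :
    ∫ t in Set.Ioi 0, wavePairing α g₀ g₁
        (partialFourierInv (∂_{((0, 1) : ℝ × ℝ)} (∂_{((0, 1) : ℝ × ℝ)} Φ))) t
      = (∫ t in Set.Ioi 0, wavePairing α (lapMul α g₀) (lapMul α g₁) (partialFourierInv Φ) t)
        - (∫ ξ, (𝓕⁻ (slice 0 (∂_{((0, 1) : ℝ × ℝ)} Φ)) : 𝓢(ℝ, ℂ)) ξ * g₀ ξ)
        + ∫ ξ, (𝓕⁻ (slice 0 Φ) : 𝓢(ℝ, ℂ)) ξ * g₁ ξ := by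
  have h0' := h₀.lapMul hα
  have h1' := h₁.lapMul hα
  set Φ' := ∂_{((0, 1) : ℝ × ℝ)} Φ
  set Φ'' := ∂_{((0, 1) : ℝ × ℝ)} Φ'
  -- Both integrations by parts at once: a primitive of the difference of the two integrands.
  have hd : ∀ t ∈ Set.Ici (0 : ℝ), HasDerivAt
      (fun t => wavePairing α g₀ g₁ (partialFourierInv Φ') t
        - wavePairing α g₁ (lapMul α g₀) (partialFourierInv Φ) t)
      (wavePairing α g₀ g₁ (partialFourierInv Φ'') t
        - wavePairing α (lapMul α g₀) (lapMul α g₁) (partialFourierInv Φ) t) t := fun t _ => by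
    refine ((hasDerivAt_wavePairing_partialFourierInv hα h₀ h₁ Φ' t).sub
      (hasDerivAt_wavePairing_partialFourierInv hα h₁ h0' Φ t)).congr_deriv ?_
    ring
  have hi1 := (integrable_wavePairing hα h₀ h₁ Φ'').integrableOn (s := Set.Ioi 0)
  have hi2 := (integrable_wavePairing hα h0' h1' Φ).integrableOn (s := Set.Ioi 0)
  have hlim := (tendsto_wavePairing_atTop α h₀ h₁ Φ').sub
    (tendsto_wavePairing_atTop α h₁ h0' Φ)
  have key := integral_Ioi_of_hasDerivAt_of_tendsto' hd (hi1.sub hi2) hlim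
  rw [integral_sub hi1 hi2, wavePairing_zero, wavePairing_zero] at key
  change _ = _ - (∫ ξ, partialFourierInv Φ' 0 ξ * g₀ ξ) + ∫ ξ, partialFourierInv Φ 0 ξ * g₁ ξ
  linear_combination key

theorem wavePairing_add (α : ℝ) {g₀ g₁ : ℝ → ℂ} (h₀ : IsTempered g₀) (h₁ : IsTempered g₁)
    (Φ Ψ : 𝓢(ℝ × ℝ, ℂ)) (t : ℝ) : wavePairing α g₀ g₁ (partialFourierInv (Φ + Ψ)) t
      = wavePairing α g₀ g₁ (partialFourierInv Φ) t
        + wavePairing α g₀ g₁ (partialFourierInv Ψ) t := by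
  have hw := isTempered_wave α h₀ h₁ t
  have h1 := (isTestFamily_partialFourierInv Φ).integrable_mul hw t
  have h2 := (isTestFamily_partialFourierInv Ψ).integrable_mul hw t
  simp only [wavePairing]
  rw [← integral_add h1 h2]
  refine integral_congr_ae (Filter.Eventually.of_forall fun ξ => ?_)
  simp only [partialFourierInv, map_add, FourierTransform.fourierInv_add, add_apply]
  ring

theorem wavePairing_smul (α : ℝ) (g₀ g₁ : ℝ → ℂ) (c : ℂ) (Φ : 𝓢(ℝ × ℝ, ℂ)) (t : ℝ) :
    wavePairing α g₀ g₁ (partialFourierInv (c • Φ)) t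
      = c * wavePairing α g₀ g₁ (partialFourierInv Φ) t := by
  simp only [wavePairing]
  rw [← integral_const_mul]
  refine integral_congr_ae (Filter.Eventually.of_forall fun ξ => ?_)
  simp only [partialFourierInv, map_smul, FourierTransform.fourierInv_smul, smul_apply, smul_eq_mul]
  ring

/-- The wave, cut off to positive times, as a distribution on space-time. -/
noncomputable def waveDistribution {α : ℝ} (hα : α ∈ Set.Ioo (1 : ℝ) 3) {g₀ g₁ : ℝ → ℂ}
    (h₀ : IsTempered g₀) (h₁ : IsTempered g₁) : 𝓢'(ℝ × ℝ, ℂ) :=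
  ContinuousLinearMap.toPointwiseConvergenceCLM _ _ _ _ <| SchwartzMap.mkCLMtoNormedSpace
    (σ := RingHom.id ℂ)
    (fun Φ => ∫ t in Set.Ioi 0, wavePairing α g₀ g₁ (partialFourierInv Φ) t)
    (fun Φ Ψ => by
      simp only [wavePairing_add α h₀ h₁]
      exact integral_add (integrable_wavePairing hα h₀ h₁ Φ).integrableOn
        (integrable_wavePairing hα h₀ h₁ Ψ).integrableOn)
    (fun c Φ => by
      simp only [wavePairing_smul]
      exact integral_const_mul _ _)
    (by
      obtain ⟨s, C, hC0, hC⟩ := exists_bound_wavePairing α h₀ h₁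
      have hint : Integrable fun t : ℝ => (1 + ‖t‖) ^ (-2 : ℝ) :=
        integrable_one_add_norm (by simp)
      refine ⟨s, C * ∫ t : ℝ in Set.Ioi 0, (1 + ‖t‖) ^ (-2 : ℝ), ?_, fun Φ => ?_⟩
      · exact mul_nonneg hC0 (integral_nonneg fun t => by positivity)
      · refine (norm_integral_le_of_norm_le (hint.const_mul
          (C * s.sup (schwartzSeminormFamily ℂ (ℝ × ℝ) ℂ) Φ)).integrableOn
          (Filter.Eventually.of_forall (hC Φ))).trans (le_of_eq ?_)
        rw [integral_const_mul]
        ring)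

theorem waveDistribution_apply {α : ℝ} (hα : α ∈ Set.Ioo (1 : ℝ) 3) {g₀ g₁ : ℝ → ℂ}
    (h₀ : IsTempered g₀) (h₁ : IsTempered g₁) (Φ : 𝓢(ℝ × ℝ, ℂ)) :
    waveDistribution hα h₀ h₁ Φ
      = ∫ t in Set.Ioi 0, wavePairing α g₀ g₁ (partialFourierInv Φ) t := rfl

/-- The wave at time `t`, cut off to `t ≥ 0`, as a distribution on space. -/
noncomputable def waveState (α : ℝ) (g₀ g₁ : ℝ → ℂ) (t : ℝ) : 𝓢'(ℝ, ℂ) :=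
  𝓕⁻ (ofTempered fun ξ => (heaviside t : ℂ) * wave α g₀ g₁ t ξ)

theorem isTempered_heaviside_mul {g : ℝ → ℂ} (hg : IsTempered g) (t : ℝ) :
    IsTempered fun ξ => (heaviside t : ℂ) * g ξ :=
  hg.mul_left aestronglyMeasurable_const ⟨‖(heaviside t : ℂ)‖, 0, fun ξ => by simp⟩

theorem isFunction_fourier_waveState (α : ℝ) {g₀ g₁ : ℝ → ℂ} (h₀ : IsTempered g₀)
    (h₁ : IsTempered g₁) (t : ℝ) :
    IsFunction (𝓕 (waveState α g₀ g₁ t)) fun ξ => (heaviside t : ℂ) * wave α g₀ g₁ t ξ := by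
  rw [waveState, fourier_fourierInv_eq]
  exact isFunction_ofTempered (isTempered_heaviside_mul (isTempered_wave α h₀ h₁ t) t)

theorem waveState_apply (α : ℝ) {g₀ g₁ : ℝ → ℂ} (h₀ : IsTempered g₀)
    (h₁ : IsTempered g₁) (t : ℝ) (φ : 𝓢(ℝ, ℂ)) : waveState α g₀ g₁ t φ
      = (heaviside t : ℂ) * wavePairing α g₀ g₁ (fun _ => (𝓕⁻ φ : 𝓢(ℝ, ℂ))) t := by
  rw [waveState, TemperedDistribution.fourierInv_apply, ofTempered_apply
    (isTempered_heaviside_mul (isTempered_wave α h₀ h₁ t) t), wavePairing, ← integral_const_mul]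
  refine integral_congr_ae (Filter.Eventually.of_forall fun ξ => ?_)
  simp only
  ring

theorem isGivenBy_waveDistribution {α : ℝ} (hα : α ∈ Set.Ioo (1 : ℝ) 3) {g₀ g₁ : ℝ → ℂ}
    (h₀ : IsTempered g₀) (h₁ : IsTempered g₁) :
    IsGivenBy (waveDistribution hα h₀ h₁) (waveState α g₀ g₁) := fun Φ _ => by
  have h : (fun t => waveState α g₀ g₁ t (slice t Φ)) = Set.indicator (Set.Ici 0)
      (wavePairing α g₀ g₁ (partialFourierInv Φ)) := by
    ext t
    rw [waveState_apply α h₀ h₁]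
    by_cases ht : 0 ≤ t
    · rw [Set.indicator_of_mem (Set.mem_Ici.2 ht)]
      simp [heaviside, ht, wavePairing, partialFourierInv]
    · rw [Set.indicator_of_notMem (by simpa using ht)]
      simp [heaviside, ht]
  rw [h]
  refine ⟨(integrable_wavePairing hα h₀ h₁ Φ).indicator measurableSet_Ici, ?_⟩
  rw [integral_indicator measurableSet_Ici, integral_Ici_eq_integral_Ioi, waveDistribution_apply]

theorem dsupport_waveDistribution_subset {α : ℝ} (hα : α ∈ Set.Ioo (1 : ℝ) 3) {g₀ g₁ : ℝ → ℂ}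
    (h₀ : IsTempered g₀) (h₁ : IsTempered g₁) :
    Distribution.dsupport (waveDistribution hα h₀ h₁) ⊆ {p : ℝ × ℝ | 0 ≤ p.2} := by
  refine fun p hp => (Distribution.mem_dsupport_iff p).1 hp _ (fun Φ hΦ => ?_)
    (isClosed_le continuous_const continuous_snd)
  rw [waveDistribution_apply]
  refine setIntegral_eq_zero_of_forall_eq_zero fun t ht => ?_
  have h : slice t Φ = 0 := by
    ext x
    refine image_eq_zero_of_notMem_tsupport (f := Φ) (x := (x, t)) fun hx => hΦ hx ?_
    exact (Set.mem_Ioi.1 ht).le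
  simp [wavePairing, partialFourierInv, h]

theorem isSmoothTempered_waveState {α : ℝ} (hα : α ∈ Set.Ioo (1 : ℝ) 3) {g₀ g₁ : ℝ → ℂ}
    (h₀ : IsTempered g₀) (h₁ : IsTempered g₁) : IsSmoothTempered (waveState α g₀ g₁) := fun φ => by
  refine (contDiff_wavePairing_const hα h₀ h₁ (𝓕⁻ φ)).contDiffOn.congr fun t ht => ?_
  rw [waveState_apply α h₀ h₁, heaviside, if_pos (Set.mem_Ioi.1 ht).le]
  simp

theorem isLapEringen_waveState {α : ℝ} (hα : α ∈ Set.Ioo (1 : ℝ) 3) {g₀ g₁ : ℝ → ℂ}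
    (h₀ : IsTempered g₀) (h₁ : IsTempered g₁) (t : ℝ) :
    IsLapEringen α (waveState α g₀ g₁ t) (waveState α (lapMul α g₀) (lapMul α g₁) t) := by
  refine isLapEringen_of_isFunction hα (isFunction_fourier_waveState α h₀ h₁ t)
    ((isFunction_fourier_waveState α (h₀.lapMul hα) (h₁.lapMul hα) t).congr
      (Filter.Eventually.of_forall fun ξ => ?_))
  simp only [wave_lapMul]
  ring

/-- The wave with data `û₀`, `v̂₀` solves the generalized Cauchy problem. -/
theorem waveDistribution_equation {α : ℝ} (hα : α ∈ Set.Ioo (1 : ℝ) 3) {g₀ g₁ : ℝ → ℂ}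
    (h₀ : IsTempered g₀) (h₁ : IsTempered g₁) {u₀ v₀ : 𝓢'(ℝ, ℂ)} (hu₀ : IsFunction (𝓕 u₀) g₀)
    (hv₀ : IsFunction (𝓕 v₀) g₁) :
    ∂_{((0, 1) : ℝ × ℝ)} (∂_{((0, 1) : ℝ × ℝ)} (waveDistribution hα h₀ h₁))
      - waveDistribution hα (h₀.lapMul hα) (h₁.lapMul hα)
      = tensorDeltaDeriv u₀ + tensorDelta v₀ := by
  have hF : ∀ {w : 𝓢'(ℝ, ℂ)} {g : ℝ → ℂ}, IsFunction (𝓕 w) g → ∀ φ : 𝓢(ℝ, ℂ),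
      ∫ ξ, (𝓕⁻ φ : 𝓢(ℝ, ℂ)) ξ * g ξ = w φ := fun {w g} hw φ => by
    rw [← (hw _).2, TemperedDistribution.fourier_apply, fourier_fourierInv_eq]
  ext Φ
  change ∂_{((0, 1) : ℝ × ℝ)} (∂_{((0, 1) : ℝ × ℝ)} (waveDistribution hα h₀ h₁)) Φ
    - waveDistribution hα (h₀.lapMul hα) (h₁.lapMul hα) Φ
      = tensorDeltaDeriv u₀ Φ + tensorDelta v₀ Φ
  rw [lineDerivOp_apply_apply, map_neg, lineDerivOp_apply_apply, map_neg, neg_neg,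
    waveDistribution_apply, waveDistribution_apply, integral_wavePairing_dt_dt hα h₀ h₁,
    hF hu₀, hF hv₀, tensorDeltaDeriv_apply, tensorDelta_apply]
  ring

/-! ### Sobolev regularity of the wave -/

theorem norm_sq_eq_integral (f : Lp ℂ 2 (volume : Measure ℝ)) : ‖f‖ ^ 2 = ∫ ξ, ‖f ξ‖ ^ 2 := by
  rw [← inner_self_eq_norm_sq (𝕜 := ℂ) f, L2.inner_def, ← integral_re (L2.integrable_inner f f)]
  simp only [inner_self_eq_norm_sq]

/-- Multiplication of a fixed `L²` function by symbols that are bounded locally uniformly in time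
and continuous in time is continuous in time, by dominated convergence. -/
theorem exists_continuous_mul_Lp {m : ℝ → ℝ → ℂ} (hm : ∀ t, AEStronglyMeasurable (m t))
    (hc : ∀ ξ, Continuous fun t => m t ξ) {C : ℝ} (hC : ∀ t ξ, ‖m t ξ‖ ≤ C * (1 + |t|))
    (a : Lp ℂ 2 (volume : Measure ℝ)) : ∃ F : ℝ → Lp ℂ 2 (volume : Measure ℝ),
      Continuous F ∧ ∀ t, F t =ᵐ[volume] fun ξ => m t ξ * a ξ := by
  have hC0 : 0 ≤ C := by simpa using (norm_nonneg (m 0 0)).trans (hC 0 0)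
  have hmem : ∀ t, MemLp (fun ξ => m t ξ * a ξ) 2 (volume : Measure ℝ) := fun t =>
    (Lp.memLp a).of_le_mul ((hm t).mul (Lp.aestronglyMeasurable a))
      (Filter.Eventually.of_forall fun ξ => by
        rw [norm_mul]
        exact mul_le_mul_of_nonneg_right (hC t ξ) (norm_nonneg _))
  refine ⟨fun t => (hmem t).toLp, continuous_iff_continuousAt.2 fun t₀ => ?_,
    fun t => (hmem t).coeFn_toLp⟩
  have hn : ∀ t, ‖(hmem t).toLp - (hmem t₀).toLp‖ ^ 2
      = ∫ ξ, ‖m t ξ - m t₀ ξ‖ ^ 2 * ‖a ξ‖ ^ 2 := fun t => by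
    rw [norm_sq_eq_integral]
    refine integral_congr_ae ?_
    filter_upwards [Lp.coeFn_sub (hmem t).toLp (hmem t₀).toLp, (hmem t).coeFn_toLp,
      (hmem t₀).coeFn_toLp] with ξ h1 h2 h3
    rw [h1, Pi.sub_apply, h2, h3, ← sub_mul, norm_mul, mul_pow]
  have hlim : Filter.Tendsto (fun t => ∫ ξ, ‖m t ξ - m t₀ ξ‖ ^ 2 * ‖a ξ‖ ^ 2) (nhds t₀)
      (nhds (∫ _ : ℝ, (0 : ℝ))) := by
    refine tendsto_integral_filter_of_dominated_convergence
      (fun ξ => (2 * (C * (2 + |t₀|))) ^ 2 * ‖a ξ‖ ^ 2) ?_ ?_ ?_ ?_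
    · exact Filter.Eventually.of_forall fun t => (((hm t).sub (hm t₀)).norm.pow 2).mul
        ((Lp.aestronglyMeasurable a).norm.pow 2)
    · filter_upwards [Metric.ball_mem_nhds t₀ one_pos] with t ht
      refine Filter.Eventually.of_forall fun ξ => ?_
      rw [Real.norm_of_nonneg (by positivity)]
      have h1 : |t - t₀| < 1 := by simpa [Real.dist_eq] using ht
      have h2 := abs_add_le (t - t₀) t₀
      rw [sub_add_cancel] at h2
      have h3 : ‖m t ξ - m t₀ ξ‖ ≤ 2 * (C * (2 + |t₀|)) := by
        refine (norm_sub_le _ _).trans ?_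
        have h4 := hC t ξ
        have h5 := hC t₀ ξ
        nlinarith
      gcongr
    · exact (Lp.memLp a).integrable_norm_pow (by norm_num) |>.const_mul _
    · refine Filter.Eventually.of_forall fun ξ => ?_
      have h1 : Continuous fun t => ‖m t ξ - m t₀ ξ‖ ^ 2 * ‖a ξ‖ ^ 2 := by
        have := hc ξ
        fun_prop
      simpa using h1.tendsto t₀
  rw [integral_zero] at hlim
  rw [ContinuousAt, tendsto_iff_norm_sub_tendsto_zero]
  have h2 := (hlim.congr fun t => (hn t).symm).sqrt
  simpa [Real.sqrt_sq (norm_nonneg _)] using h2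

/-- The gain `1 - α/2` of the data `v₀`: `sin(h_α t) / h_α` has order `α/2 - 1` at infinity. -/
theorem exists_bound_sin_div_mul_rpow {α : ℝ} (hα : α ∈ Set.Ioo (1 : ℝ) 3) :
    ∃ C : ℝ, ∀ t ξ : ℝ, |Real.sin (angFreq α ξ * t) / angFreq α ξ|
      * (1 + ‖ξ‖ ^ 2) ^ ((1 - α / 2) / 2) ≤ C * (1 + |t|) := by
  have ha := aConst_pos hα
  obtain ⟨hα1, hα3⟩ := hα
  set e := (1 - α / 2) / 2 with he
  have hpi := Real.pi_gt_three
  set K : ℝ := 1 + ((2 * Real.pi) ^ 2) ^ (-e)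
  have hK : 0 ≤ K := by positivity
  have hK1 : 0 ≤ √(1 + aConst α) * K := by positivity
  refine ⟨2 + √(1 + aConst α) * K, fun t ξ => ?_⟩
  have hy1 : (1 : ℝ) ≤ 1 + ‖ξ‖ ^ 2 := by nlinarith [sq_nonneg ‖ξ‖]
  -- Small frequencies: `|sin(h t) / h| ≤ |t|`. Large frequencies: `|sin(h t) / h| ≤ 1 / h`.
  rcases le_or_gt |ξ| 1 with hξ | hξ
  · have h1 : (1 + ‖ξ‖ ^ 2) ^ e ≤ 2 := by
      calc (1 + ‖ξ‖ ^ 2) ^ e ≤ (1 + ‖ξ‖ ^ 2) ^ (1 : ℝ) :=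
            Real.rpow_le_rpow_of_exponent_le hy1 (by rw [he]; linarith)
        _ ≤ 2 := by
          rw [Real.rpow_one, Real.norm_eq_abs]
          nlinarith [abs_nonneg ξ]
    calc _ ≤ |t| * 2 :=
          mul_le_mul (abs_sin_div_le t _) h1 (by positivity) (abs_nonneg t)
      _ ≤ _ := by nlinarith [abs_nonneg t]
  · set η := |2 * Real.pi * ξ| with hη
    have hηξ : η = 2 * Real.pi * |ξ| := by
      rw [hη, abs_mul, abs_of_pos Real.two_pi_pos]
    have hη1 : 1 ≤ η := by rw [hηξ]; nlinarith
    have hη0 : 0 < η := by linarith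
    have hsq : √(1 + aConst α * η ^ α) ≤ √(1 + aConst α) * η ^ (α / 2) := by
      rw [Real.sqrt_le_left (by positivity), mul_pow, Real.sq_sqrt (by linarith),
        ← Real.rpow_mul_natCast hη0.le]
      have h1 : η ^ (α / 2 * (2 : ℕ)) = η ^ α := by
        congr 1
        push_cast
        ring
      rw [h1]
      have h2 : 1 ≤ η ^ α := Real.one_le_rpow hη1 (by linarith)
      nlinarith
    have h2e : (η ^ 2) ^ e = η ^ (1 - α / 2) := by
      rw [← Real.rpow_natCast_mul hη0.le]
      congr 1
      rw [he]
      push_cast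
      ring
    have hye : (1 + ‖ξ‖ ^ 2) ^ e ≤ K * η ^ (1 - α / 2) := by
      rw [← h2e, Real.norm_eq_abs]
      have hpos : 0 ≤ (η ^ 2) ^ e := by positivity
      -- The exponent is negative for `α > 2`, and the two cases use opposite bounds on the base.
      rcases le_total 0 e with h0 | h0
      · have h1 : (1 + |ξ| ^ 2) ^ e ≤ (η ^ 2) ^ e := by
          refine Real.rpow_le_rpow (by positivity) ?_ h0
          rw [hηξ, mul_pow]
          have h2 : 2 ≤ (2 * Real.pi) ^ 2 := by nlinarith
          nlinarith [sq_nonneg |ξ|]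
        have h2 : 1 ≤ K := le_add_of_nonneg_right (by positivity)
        nlinarith
      · have h1 : ((2 * Real.pi) ^ 2 * (1 + |ξ| ^ 2)) ^ e ≤ (η ^ 2) ^ e := by
          refine Real.rpow_le_rpow_of_nonpos (by positivity) ?_ h0
          rw [hηξ, mul_pow]
          have : (0 : ℝ) ≤ (2 * Real.pi) ^ 2 := by positivity
          nlinarith
        rw [Real.mul_rpow (by positivity) (by positivity)] at h1
        have h3 : ((2 * Real.pi) ^ 2) ^ (-e) * ((2 * Real.pi) ^ 2) ^ e = 1 := by
          rw [← Real.rpow_add (by positivity)]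
          simp
        calc (1 + |ξ| ^ 2) ^ e
            = ((2 * Real.pi) ^ 2) ^ (-e) * (((2 * Real.pi) ^ 2) ^ e * (1 + |ξ| ^ 2) ^ e) := by
              rw [← mul_assoc, h3, one_mul]
          _ ≤ ((2 * Real.pi) ^ 2) ^ (-e) * (η ^ 2) ^ e := by gcongr
          _ ≤ K * (η ^ 2) ^ e := by
            gcongr
            exact le_add_of_nonneg_left zero_le_one
    have hS : 0 < √(1 + aConst α * η ^ α) := by
      have : 0 ≤ aConst α * η ^ α := by positivity
      exact Real.sqrt_pos.2 (by linarith)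
    have hω : angFreq α ξ = η / √(1 + aConst α * η ^ α) := rfl
    have hω0 : 0 < angFreq α ξ := by rw [hω]; positivity
    have hsin : |Real.sin (angFreq α ξ * t) / angFreq α ξ|
        ≤ √(1 + aConst α * η ^ α) / η := by
      rw [abs_div, abs_of_pos hω0]
      calc _ ≤ 1 / angFreq α ξ := by gcongr; exact Real.abs_sin_le_one _
        _ = _ := by rw [hω, one_div_div]
    calc _ ≤ √(1 + aConst α * η ^ α) / η * (K * η ^ (1 - α / 2)) := by gcongr
      _ ≤ (√(1 + aConst α) * η ^ (α / 2)) / η * (K * η ^ (1 - α / 2)) := by gcongr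
      _ = √(1 + aConst α) * K * (η ^ (α / 2) * η ^ (1 - α / 2)) / η := by ring
      _ = √(1 + aConst α) * K := by
        rw [← Real.rpow_add hη0]
        have : α / 2 + (1 - α / 2) = 1 := by ring
        rw [this, Real.rpow_one]
        field_simp
      _ ≤ _ := by nlinarith [abs_nonneg t]

theorem besselWeight_mul (s r ξ : ℝ) :
    besselWeight s ξ * besselWeight r ξ = besselWeight (s + r) ξ := by
  unfold besselWeight
  rw [← Complex.ofReal_mul, ← Real.rpow_add (by positivity)]
  ring_nf

/-- The Sobolev regularity of the wave: after removal of the weight of `H^s`, it is a continuous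
function of time with values in `L²`. -/
theorem exists_continuous_wave_Lp {α : ℝ} (hα : α ∈ Set.Ioo (1 : ℝ) 3) (s : ℝ)
    (a b : Lp ℂ 2 (volume : Measure ℝ)) : ∃ F : ℝ → Lp ℂ 2 (volume : Measure ℝ), Continuous F ∧
      ∀ t, wave α (fun ξ => besselWeight (-s) ξ * a ξ)
        (fun ξ => besselWeight (-(s - 1 + α / 2)) ξ * b ξ) t
          =ᵐ[volume] fun ξ => besselWeight (-s) ξ * F t ξ := by
  have hω := measurable_angFreq α
  obtain ⟨F₀, hF₀, hF₀'⟩ := exists_continuous_mul_Lp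
    (m := fun t ξ => (Real.cos (angFreq α ξ * t) : ℂ)) (C := 1)
    (fun t => Measurable.aestronglyMeasurable (by fun_prop)) (fun ξ => by fun_prop)
    (fun t ξ => by
      rw [Complex.norm_real, Real.norm_eq_abs]
      linarith [Real.abs_cos_le_one (angFreq α ξ * t), abs_nonneg t]) a
  obtain ⟨C, hC⟩ := exists_bound_sin_div_mul_rpow hα
  have hbw := (hasTemperateGrowth_besselWeight (1 - α / 2)).1.continuous.measurable
  obtain ⟨F₁, hF₁, hF₁'⟩ := exists_continuous_mul_Lp
    (m := fun t ξ => ((Real.sin (angFreq α ξ * t) / angFreq α ξ : ℝ) : ℂ)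
      * besselWeight (1 - α / 2) ξ) (C := C)
    (fun t => Measurable.aestronglyMeasurable (by fun_prop)) (fun ξ => by fun_prop)
    (fun t ξ => by
      rw [norm_mul, Complex.norm_real, Real.norm_eq_abs, besselWeight, Complex.norm_real,
        Real.norm_of_nonneg (by positivity)]
      exact hC t ξ) b
  refine ⟨fun t => F₀ t + F₁ t, hF₀.add hF₁, fun t => ?_⟩
  filter_upwards [Lp.coeFn_add (F₀ t) (F₁ t), hF₀' t, hF₁' t] with ξ h1 h2 h3
  rw [h1, Pi.add_apply, h2, h3, wave]
  have h4 : besselWeight (-(s - 1 + α / 2)) ξ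
      = besselWeight (-s) ξ * besselWeight (1 - α / 2) ξ := by
    rw [besselWeight_mul]
    congr 1
    ring
  rw [h4]
  ring

/-- The wave, cut off to `t ≥ 0`, corresponds under the Bessel potential to a continuous function of
time with values in `L²`, cut off to `t ≥ 0`. -/
theorem exists_waveState_eq {α : ℝ} (hα : α ∈ Set.Ioo (1 : ℝ) 3) (s : ℝ)
    (a b : Lp ℂ 2 (volume : Measure ℝ)) : ∃ F : ℝ → Lp ℂ 2 (volume : Measure ℝ), Continuous F ∧
      ∀ t, besselPotential ℝ ℂ s (waveState α (fun ξ => besselWeight (-s) ξ * a ξ)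
        (fun ξ => besselWeight (-(s - 1 + α / 2)) ξ * b ξ) t)
          = ((Set.indicator (Set.Ici 0) F t : Lp ℂ 2 (volume : Measure ℝ)) : 𝓢'(ℝ, ℂ)) := by
  obtain ⟨F, hF, hF'⟩ := exists_continuous_wave_Lp hα s a b
  refine ⟨fun t => (𝓕⁻ (F t) : Lp ℂ 2 (volume : Measure ℝ)),
    (FourierTransform.continuous_fourierInv).comp hF, fun t => ?_⟩
  have h₀ := (isTempered_of_memLp_two (Lp.memLp a)).mul_left_of_hasTemperateGrowth
    (hasTemperateGrowth_besselWeight (-s))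
  have h₁ := (isTempered_of_memLp_two (Lp.memLp b)).mul_left_of_hasTemperateGrowth
    (hasTemperateGrowth_besselWeight (-(s - 1 + α / 2)))
  rw [besselPotential_eq_iff]
  refine (isFunction_fourier_waveState α h₀ h₁ t).congr ?_
  by_cases ht : 0 ≤ t
  · rw [Set.indicator_of_mem (Set.mem_Ici.2 ht), fourier_fourierInv_eq]
    filter_upwards [hF' t] with ξ hξ
    rw [hξ, heaviside, if_pos ht]
    simp
  · rw [Set.indicator_of_notMem (by simpa using ht), FourierTransform.fourier_zero]
    filter_upwards [Lp.coeFn_zero ℂ 2 (volume : Measure ℝ)] with ξ hξ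
    rw [hξ, heaviside, if_neg ht]
    simp

/-! ### Time averages and tensor products of test functions -/

/-- The tensor product `φ ⊗ χ` of test functions in space and time. -/
noncomputable def tensorTest {φ : 𝓢(ℝ, ℂ)} (hφ : HasCompactSupport φ) {χ : ℝ → ℝ}
    (h1 : ContDiff ℝ ∞ χ) (h2 : HasCompactSupport χ) : 𝓢(ℝ × ℝ, ℂ) :=
  HasCompactSupport.toSchwartzMap (f := fun p : ℝ × ℝ => (χ p.2 : ℂ) * φ p.1)
    (HasCompactSupport.intro (hφ.isCompact.prod h2.isCompact) fun p hp => by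
      by_cases h : p.1 ∈ tsupport φ
      · have : χ p.2 = 0 := image_eq_zero_of_notMem_tsupport fun h' => hp ⟨h, h'⟩
        simp [this]
      · simp [image_eq_zero_of_notMem_tsupport h])
    ((Complex.ofRealCLM.contDiff.comp (h1.comp contDiff_snd)).mul
      ((φ.smooth ⊤).comp contDiff_fst))

section TensorTest

variable {φ : 𝓢(ℝ, ℂ)} (hφ : HasCompactSupport φ) {χ : ℝ → ℝ} (h1 : ContDiff ℝ ∞ χ)
  (h2 : HasCompactSupport χ)

theorem tensorTest_apply (p : ℝ × ℝ) : tensorTest hφ h1 h2 p = (χ p.2 : ℂ) * φ p.1 := rfl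

theorem tsupport_tensorTest_subset :
    tsupport (tensorTest hφ h1 h2) ⊆ tsupport φ ×ˢ tsupport χ := by
  refine closure_minimal (fun p hp => ?_) ((isClosed_tsupport _).prod (isClosed_tsupport _))
  rw [Function.mem_support, tensorTest_apply] at hp
  refine ⟨subset_tsupport _ ?_, subset_tsupport _ ?_⟩
  · exact right_ne_zero_of_mul hp
  · exact_mod_cast left_ne_zero_of_mul hp

theorem hasCompactSupport_tensorTest : HasCompactSupport (tensorTest hφ h1 h2) :=
  (hφ.isCompact.prod h2.isCompact).of_isClosed_subset (isClosed_tsupport _)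
    (tsupport_tensorTest_subset hφ h1 h2)

theorem slice_tensorTest (t : ℝ) : slice t (tensorTest hφ h1 h2) = (χ t : ℂ) • φ := by
  ext x
  rw [slice_apply, tensorTest_apply, smul_apply, smul_eq_mul]

theorem contDiff_deriv_of_contDiff {χ : ℝ → ℝ} (h1 : ContDiff ℝ ∞ χ) : ContDiff ℝ ∞ (deriv χ) :=
  (contDiff_infty_iff_deriv.1 h1).2

theorem lineDeriv_tensorTest : ∂_{((0, 1) : ℝ × ℝ)} (tensorTest hφ h1 h2)
    = tensorTest hφ (contDiff_deriv_of_contDiff h1) h2.deriv := by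
  ext ⟨x, t⟩
  have hd : HasDerivAt χ (deriv χ t) t :=
    ((h1.differentiable (by simp)) t).hasDerivAt
  exact (hasDerivAt_slice_apply (tensorTest hφ h1 h2) t x).unique
    (hd.ofReal_comp.mul_const (φ x))

end TensorTest

/-- The average `∫ χ(t) F(t) dt` of a function of time with values in `L²`. -/
noncomputable def timeAverage (F : ℝ → Lp ℂ 2 (volume : Measure ℝ)) (χ : ℝ → ℝ) :
    Lp ℂ 2 (volume : Measure ℝ) := ∫ t, χ t • F t

section Average

variable {F : ℝ → Lp ℂ 2 (volume : Measure ℝ)}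

/-- The time average may be exchanged with pairings in the frequency variable. -/
theorem integral_mul_integral_eq (hF : LocallyIntegrable F) {χ : ℝ → ℝ} (hχ : Continuous χ)
    (hχ' : HasCompactSupport χ) {k : ℝ → ℂ} (hk : MemLp k 2 (volume : Measure ℝ)) :
    ∫ t, (χ t : ℂ) * ∫ ξ, k ξ * F t ξ = ∫ ξ, k ξ * timeAverage F χ ξ := by
  set L : Lp ℂ 2 (volume : Measure ℝ) →L[ℂ] ℂ :=
    (ContinuousLinearMap.mul ℂ ℂ).lpPairing volume 2 2 hk.toLp
  have hL : ∀ a : Lp ℂ 2 (volume : Measure ℝ), L a = ∫ ξ, k ξ * a ξ := fun a => by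
    rw [ContinuousLinearMap.lpPairing_eq_integral]
    refine integral_congr_ae ?_
    filter_upwards [hk.coeFn_toLp] with ξ hξ
    rw [hξ, ContinuousLinearMap.mul_apply']
  simp only [← hL]
  rw [timeAverage, ← L.integral_comp_comm (hF.integrable_smul_left_of_hasCompactSupport hχ hχ')]
  refine integral_congr_ae (Filter.Eventually.of_forall fun t => ?_)
  simp only
  rw [L.map_smul_of_tower, Complex.real_smul]

/-- A distribution given by functions of time, tested against products, sees only time averages. -/
theorem apply_tensorTest_eq (hF : LocallyIntegrable F) {n : ℝ → ℂ}
    (hn : ∀ φ : 𝓢(ℝ, ℂ), MemLp (fun ξ => φ ξ * n ξ) 2 (volume : Measure ℝ))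
    {d : 𝓢'(ℝ × ℝ, ℂ)} {D : ℝ → 𝓢'(ℝ, ℂ)} (hd : IsGivenBy d D)
    (hD : ∀ t, IsFunction (𝓕 (D t)) fun ξ => n ξ * F t ξ)
    {φ : 𝓢(ℝ, ℂ)} (hφ : HasCompactSupport φ) {χ : ℝ → ℝ} (h1 : ContDiff ℝ ∞ χ)
    (h2 : HasCompactSupport χ) : d (tensorTest hφ h1 h2)
      = ∫ ξ, (𝓕⁻ φ : 𝓢(ℝ, ℂ)) ξ * (n ξ * timeAverage F χ ξ) := by
  rw [(hd _ (hasCompactSupport_tensorTest hφ h1 h2)).2]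
  simp only [slice_tensorTest, map_smul, smul_eq_mul, ← mul_assoc]
  rw [← integral_mul_integral_eq hF h1.continuous h2 (hn _)]
  refine integral_congr_ae (Filter.Eventually.of_forall fun t => ?_)
  simp only
  have h := (hD t (𝓕⁻ φ)).2
  rw [TemperedDistribution.fourier_apply, fourier_fourierInv_eq] at h
  simp only [h, ← mul_assoc]

theorem ae_eq_zero_of_integral_fourierInv_mul_eq_zero {g : ℝ → ℂ} (hg : IsTempered g)
    (h : ∀ φ : 𝓢(ℝ, ℂ), HasCompactSupport φ → ∫ ξ, (𝓕⁻ φ : 𝓢(ℝ, ℂ)) ξ * g ξ = 0) :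
    g =ᵐ[volume] 0 := by
  have h1 : (𝓕⁻ (ofTempered g) : 𝓢'(ℝ, ℂ)) = 0 :=
    eq_of_eq_on_hasCompactSupport fun φ hφ => by
      rw [TemperedDistribution.fourierInv_apply, ofTempered_apply hg, h φ hφ]
      rfl
  have h2 : IsFunction (ofTempered g) 0 := fun φ => by
    have h3 : ofTempered g φ = (𝓕⁻ (ofTempered g) : 𝓢'(ℝ, ℂ)) (𝓕 φ) := by
      rw [TemperedDistribution.fourierInv_apply, fourierInv_fourier_eq]
    rw [h3, h1]
    refine ⟨by simp, ?_⟩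
    simp only [Pi.zero_apply, mul_zero, integral_zero]
    rfl
  exact (isFunction_ofTempered hg).ae_eq h2

theorem besselWeight_ne_zero (s ξ : ℝ) : besselWeight s ξ ≠ 0 := by
  unfold besselWeight
  exact_mod_cast (by positivity : (0 : ℝ) < (1 + ‖ξ‖ ^ 2) ^ (s / 2)).ne'

theorem memLp_mul_besselWeight (s : ℝ) (φ : 𝓢(ℝ, ℂ)) :
    MemLp (fun ξ => φ ξ * besselWeight s ξ) 2 (volume : Measure ℝ) := by
  have h := (SchwartzMap.smulLeftCLM ℂ (besselWeight s) φ).memLp 2 (volume : Measure ℝ)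
  rw [SchwartzMap.smulLeftCLM_apply (hasTemperateGrowth_besselWeight s)] at h
  refine h.ae_eq (Filter.Eventually.of_forall fun ξ => ?_)
  simp [mul_comm]

/-- The symbol `h_α²` costs at most two derivatives. -/
theorem memLp_mul_lapMul_besselWeight {α : ℝ} (hα : α ∈ Set.Ioo (1 : ℝ) 3) (s : ℝ) (φ : 𝓢(ℝ, ℂ)) :
    MemLp (fun ξ => φ ξ * lapMul α (besselWeight s) ξ) 2 (volume : Measure ℝ) := by
  have hm := measurable_angFreq α
  have hb := (hasTemperateGrowth_besselWeight s).1.continuous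
  have hφ := φ.continuous
  refine (memLp_mul_besselWeight (s + 2) φ).of_le_mul (c := 2 * (2 * Real.pi) ^ 2)
    (Measurable.aestronglyMeasurable (by unfold lapMul; fun_prop))
    (Filter.Eventually.of_forall fun ξ => ?_)
  have h1 : angFreq α ξ ^ 2 ≤ (2 * Real.pi) ^ 2 * (2 * (1 + |ξ| ^ 2)) := by
    calc angFreq α ξ ^ 2 ≤ (2 * Real.pi * (1 + |ξ|)) ^ 2 :=
          pow_le_pow_left₀ (angFreq_nonneg α ξ) (angFreq_le hα ξ) 2
      _ = (2 * Real.pi) ^ 2 * (1 + |ξ|) ^ 2 := mul_pow _ _ _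
      _ ≤ _ := by
        gcongr
        nlinarith [sq_nonneg (1 - |ξ|)]
  have h2 : ‖besselWeight (s + 2) ξ‖ = ‖besselWeight s ξ‖ * (1 + |ξ| ^ 2) := by
    rw [← besselWeight_mul, norm_mul]
    congr 1
    rw [besselWeight, Complex.norm_real, Real.norm_of_nonneg (by positivity)]
    norm_num
  rw [norm_mul, norm_mul, h2, lapMul, norm_mul, norm_neg, norm_pow, Complex.norm_real,
    Real.norm_of_nonneg (angFreq_nonneg α ξ)]
  calc ‖φ ξ‖ * (angFreq α ξ ^ 2 * ‖besselWeight s ξ‖)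
      ≤ ‖φ ξ‖ * ((2 * Real.pi) ^ 2 * (2 * (1 + |ξ| ^ 2)) * ‖besselWeight s ξ‖) := by gcongr
    _ = _ := by ring

theorem isTempered_besselWeight_mul (s : ℝ) (a : Lp ℂ 2 (volume : Measure ℝ)) :
    IsTempered fun ξ => besselWeight s ξ * a ξ :=
  (isTempered_of_memLp_two (Lp.memLp a)).mul_left_of_hasTemperateGrowth
    (hasTemperateGrowth_besselWeight s)

/-- The equation `∂_t² d = e` between space-time distributions, tested against products: an
ordinary differential equation in `t` for almost every frequency, in averaged form. -/
theorem timeAverage_deriv_deriv {α : ℝ} (hα : α ∈ Set.Ioo (1 : ℝ) 3) {s : ℝ}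
    (hF : LocallyIntegrable F) {d e : 𝓢'(ℝ × ℝ, ℂ)} {D W : ℝ → 𝓢'(ℝ, ℂ)} (hd : IsGivenBy d D)
    (he : IsGivenBy e W) (hD : ∀ t, IsFunction (𝓕 (D t)) fun ξ => besselWeight (-s) ξ * F t ξ)
    (hW : ∀ t, IsFunction (𝓕 (W t)) fun ξ =>
      -(angFreq α ξ : ℂ) ^ 2 * (besselWeight (-s) ξ * F t ξ))
    (heq : ∂_{((0, 1) : ℝ × ℝ)} (∂_{((0, 1) : ℝ × ℝ)} d) = e) {χ : ℝ → ℝ}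
    (h1 : ContDiff ℝ ∞ χ) (h2 : HasCompactSupport χ) :
    ∀ᵐ ξ, timeAverage F (deriv (deriv χ)) ξ = -(angFreq α ξ : ℂ) ^ 2 * timeAverage F χ ξ := by
  have hg := isTempered_besselWeight_mul (-s) (timeAverage F (deriv (deriv χ)))
  have hg' := (isTempered_besselWeight_mul (-s) (timeAverage F χ)).neg_angFreq_sq_mul hα
  have hW' : ∀ t, IsFunction (𝓕 (W t)) fun ξ => lapMul α (besselWeight (-s)) ξ * F t ξ :=
    fun t => by simpa only [lapMul, mul_assoc] using hW t
  have hsum : (fun ξ => besselWeight (-s) ξ * timeAverage F (deriv (deriv χ)) ξ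
      + -1 * (-(angFreq α ξ : ℂ) ^ 2 * (besselWeight (-s) ξ * timeAverage F χ ξ)))
      =ᵐ[volume] 0 := by
    refine ae_eq_zero_of_integral_fourierInv_mul_eq_zero (hg.add (hg'.mul_left
      (m := fun _ => -1) aestronglyMeasurable_const ⟨1, 0, fun ξ => by simp⟩)) fun φ hφ => ?_
    have e1 : e (tensorTest hφ h1 h2) = d (tensorTest hφ
        (contDiff_deriv_of_contDiff (contDiff_deriv_of_contDiff h1)) h2.deriv.deriv) := by
      rw [← heq, lineDerivOp_apply_apply, map_neg, lineDerivOp_apply_apply, map_neg, neg_neg,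
        lineDeriv_tensorTest, lineDeriv_tensorTest]
    rw [apply_tensorTest_eq hF (memLp_mul_lapMul_besselWeight hα (-s)) he hW' hφ h1 h2,
      apply_tensorTest_eq hF (memLp_mul_besselWeight (-s)) hd hD hφ] at e1
    simp only [mul_add]
    rw [integral_add (hg.integrable_mul _), ← e1, ← integral_add]
    · refine integral_eq_zero_of_ae (Filter.Eventually.of_forall fun ξ => ?_)
      simp only [lapMul, Pi.zero_apply]
      ring
    · refine (hg'.integrable_mul (𝓕⁻ φ)).congr (Filter.Eventually.of_forall fun ξ => ?_)
      simp only [lapMul]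
      ring
    · refine (hg'.integrable_mul (𝓕⁻ φ)).neg.congr (Filter.Eventually.of_forall fun ξ => ?_)
      simp only [Pi.neg_apply]
      ring
    · refine (hg'.integrable_mul (𝓕⁻ φ)).neg.congr (Filter.Eventually.of_forall fun ξ => ?_)
      simp only [Pi.neg_apply]
      ring
  filter_upwards [hsum] with ξ hξ
  refine mul_left_cancel₀ (besselWeight_ne_zero (-s) ξ) ?_
  simp only [Pi.zero_apply] at hξ
  linear_combination hξ

/-- A distribution that vanishes for `t < 0` is given by functions that vanish there. -/
theorem ae_eq_zero_of_neg {s : ℝ} (hF : LocallyIntegrable F) {d : 𝓢'(ℝ × ℝ, ℂ)}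
    {D : ℝ → 𝓢'(ℝ, ℂ)} (hd : IsGivenBy d D)
    (hD : ∀ t, IsFunction (𝓕 (D t)) fun ξ => besselWeight (-s) ξ * F t ξ)
    (hsupp : ∀ Φ : 𝓢(ℝ × ℝ, ℂ), HasCompactSupport Φ → tsupport Φ ⊆ {p | p.2 < 0} → d Φ = 0) :
    ∀ᵐ t, t < 0 → F t = 0 := by
  refine isOpen_Iio.ae_eq_zero_of_integral_contDiff_smul_eq_zero (hF.locallyIntegrableOn _)
    fun χ h1 h2 h3 => ?_
  have h4 : (fun ξ => besselWeight (-s) ξ * timeAverage F χ ξ) =ᵐ[volume] 0 := by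
    refine ae_eq_zero_of_integral_fourierInv_mul_eq_zero
      (isTempered_besselWeight_mul (-s) _) fun φ hφ => ?_
    rw [← apply_tensorTest_eq hF (memLp_mul_besselWeight (-s)) hd hD hφ h1 h2]
    exact hsupp _ (hasCompactSupport_tensorTest hφ h1 h2)
      fun p hp => h3 (tsupport_tensorTest_subset hφ h1 h2 hp).2
  change timeAverage F χ = 0
  rw [Lp.eq_zero_iff_ae_eq_zero]
  filter_upwards [h4] with ξ hξ
  exact (mul_eq_zero.1 hξ).resolve_left (besselWeight_ne_zero (-s) ξ)

end Average

/-! ### Backward primitives of test functions -/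

/-- The primitive `t ↦ ∫_t^T f`, which vanishes at `T`. -/
noncomputable def backPrimitive (T : ℝ) (f : ℝ → ℝ) (t : ℝ) : ℝ := ∫ x in t..T, f x

theorem hasDerivAt_backPrimitive (T : ℝ) {f : ℝ → ℝ} (hf : Continuous f) (t : ℝ) :
    HasDerivAt (backPrimitive T f) (-f t) t :=
  intervalIntegral.integral_hasDerivAt_left (hf.intervalIntegrable _ _)
    hf.aestronglyMeasurable.stronglyMeasurableAtFilter hf.continuousAt

theorem contDiff_backPrimitive (T : ℝ) {f : ℝ → ℝ} (hf : ContDiff ℝ ∞ f) :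
    ContDiff ℝ ∞ (backPrimitive T f) := by
  have hd := hasDerivAt_backPrimitive T hf.continuous
  refine contDiff_infty_iff_deriv.2 ⟨fun t => (hd t).differentiableAt, ?_⟩
  rw [funext fun t => (hd t).deriv]
  exact hf.neg

theorem backPrimitive_eq_zero {T : ℝ} {f : ℝ → ℝ} (hf : ∀ t, T ≤ t → f t = 0) {t : ℝ}
    (ht : T ≤ t) : backPrimitive T f t = 0 := by
  rw [backPrimitive, intervalIntegral.integral_symm, intervalIntegral.integral_congr (g := 0)]
  · simp
  · intro x hx
    rw [Set.uIcc_of_le ht] at hx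
    exact hf x hx.1

/-- Each backward primitive gains a factor `(T - t) / (k + 1)`. -/
theorem abs_backPrimitive_le {T M : ℝ} {k : ℕ} {f : ℝ → ℝ}
    (hf : ∀ t ∈ Set.Icc 0 T, |f t| ≤ M * ((T - t) ^ k / k.factorial)) {t : ℝ}
    (ht : t ∈ Set.Icc 0 T) :
    |backPrimitive T f t| ≤ M * ((T - t) ^ (k + 1) / (k + 1).factorial) := by
  have h1 : |backPrimitive T f t| ≤ ∫ x in t..T, M * ((T - x) ^ k / k.factorial) := by
    rw [backPrimitive, ← Real.norm_eq_abs]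
    refine intervalIntegral.norm_integral_le_of_norm_le ht.2
      (Filter.Eventually.of_forall fun x hx => ?_)
      (Continuous.intervalIntegrable (by fun_prop) _ _)
    exact hf x ⟨ht.1.trans hx.1.le, hx.2⟩
  refine h1.trans (le_of_eq ?_)
  rw [intervalIntegral.integral_const_mul, intervalIntegral.integral_div,
    intervalIntegral.integral_comp_sub_left (fun x => x ^ k), integral_pow, Nat.factorial_succ]
  push_cast
  rw [sub_self]
  have : (0 : ℝ) < k.factorial := by positivity
  field_simp
  simp

/-- A test function `χ` is a second derivative on `t ≥ 0`, of a test function that is small to the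
left of `T` if `χ` vanishes beyond `T`: integrate twice from the right, then cut off where
`t < 0`. -/
theorem exists_deriv_deriv_eq {T M : ℝ} {k : ℕ} {χ : ℝ → ℝ} (h1 : ContDiff ℝ ∞ χ)
    (hT : ∀ t, T ≤ t → χ t = 0)
    (hM : ∀ t ∈ Set.Icc 0 T, |χ t| ≤ M * ((T - t) ^ k / k.factorial)) :
    ∃ χ' : ℝ → ℝ, ContDiff ℝ ∞ χ' ∧ HasCompactSupport χ' ∧ (∀ t, T ≤ t → χ' t = 0) ∧
      (∀ t ∈ Set.Icc 0 T, |χ' t| ≤ M * ((T - t) ^ (k + 2) / (k + 2).factorial)) ∧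
      ∀ t, 0 ≤ t → deriv (deriv χ') t = χ t := by
  set p := backPrimitive T (backPrimitive T χ) with hp
  -- The cutoff is `1` on `t ≥ -1/2`, a neighbourhood of `t ≥ 0`, so that derivatives at `0` agree.
  set κ : ℝ → ℝ := fun t => Real.smoothTransition (2 * t + 2) with hκ
  have hp0 : ∀ t, T ≤ t → p t = 0 := fun t ht =>
    backPrimitive_eq_zero (fun s hs => backPrimitive_eq_zero hT hs) ht
  have hκ0 : ∀ t, t ≤ -1 → κ t = 0 := fun t ht =>
    Real.smoothTransition.zero_of_nonpos (by linarith)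
  have hκ1 : ∀ t, -(1 / 2) ≤ t → κ t = 1 := fun t ht =>
    Real.smoothTransition.one_of_one_le (by linarith)
  have hps : ContDiff ℝ ∞ p := contDiff_backPrimitive T (contDiff_backPrimitive T h1)
  have hκs : ContDiff ℝ ∞ κ := Real.smoothTransition.contDiff.comp (by fun_prop)
  have hd1 : deriv p = fun t => -backPrimitive T χ t :=
    funext fun t => (hasDerivAt_backPrimitive T (contDiff_backPrimitive T h1).continuous t).deriv
  have hd2 : deriv (deriv p) = χ := by
    rw [hd1]
    exact funext fun t => by
      simpa using (hasDerivAt_backPrimitive T h1.continuous t).neg.deriv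
  refine ⟨fun t => κ t * p t, hκs.mul hps, ?_, fun t ht => by simp only [hp0 t ht, mul_zero],
    fun t ht => ?_, fun t ht => ?_⟩
  · refine HasCompactSupport.intro (isCompact_Icc (a := -1) (b := T)) fun t ht => ?_
    rcases lt_or_ge t (-1) with h | h
    · rw [hκ0 t h.le, zero_mul]
    · rw [hp0 t (not_le.1 fun h' => ht ⟨h, h'⟩).le, mul_zero]
  · simp only [hκ1 t (by linarith [ht.1]), one_mul]
    exact abs_backPrimitive_le (fun s hs => abs_backPrimitive_le hM hs) ht
  · have h2 : (fun t => κ t * p t) =ᶠ[nhds t] p := by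
      filter_upwards [Ioi_mem_nhds (show -(1 / 2 : ℝ) < t by linarith)] with r hr
      rw [hκ1 r (Set.mem_Ioi.1 hr).le, one_mul]
    rw [h2.deriv.deriv_eq, hd2]

/-! ### Uniqueness -/

section Uniqueness

variable {F : ℝ → Lp ℂ 2 (volume : Measure ℝ)}

/-- Only the values of the test function for `t ≥ 0` matter. -/
theorem timeAverage_congr (hneg : ∀ᵐ t, t < 0 → F t = 0) {χ χ' : ℝ → ℝ}
    (h : ∀ t, 0 ≤ t → χ t = χ' t) : timeAverage F χ = timeAverage F χ' := by
  refine integral_congr_ae ?_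
  filter_upwards [hneg] with t ht
  rcases lt_or_ge t 0 with h0 | h0
  · rw [ht h0, smul_zero, smul_zero]
  · rw [h t h0]

theorem norm_timeAverage_le (hF : LocallyIntegrable F) (hneg : ∀ᵐ t, t < 0 → F t = 0) {T B : ℝ}
    {χ : ℝ → ℝ} (hT : ∀ t, T ≤ t → χ t = 0) (hB : ∀ t ∈ Set.Icc 0 T, |χ t| ≤ B) :
    ‖timeAverage F χ‖ ≤ B * ∫ t in Set.Icc 0 T, ‖F t‖ := by
  have hi : IntegrableOn (fun t => ‖F t‖) (Set.Icc 0 T) :=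
    (hF.integrableOn_isCompact isCompact_Icc).norm
  rw [← integral_const_mul, ← integral_indicator measurableSet_Icc]
  refine norm_integral_le_of_norm_le ((integrable_indicator_iff measurableSet_Icc).2 (hi.const_mul B)) ?_
  filter_upwards [hneg] with t ht
  by_cases h : t ∈ Set.Icc 0 T
  · rw [Set.indicator_of_mem h, norm_smul, Real.norm_eq_abs]
    exact mul_le_mul_of_nonneg_right (hB t h) (norm_nonneg _)
  · rw [Set.indicator_of_notMem h]
    rcases lt_or_ge t 0 with h0 | h0
    · rw [ht h0, smul_zero, norm_zero]
    · rw [hT t (not_le.1 fun h' => h ⟨h0, h'⟩).le, zero_smul, norm_zero]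

/-- Iterating the equation: `∫ χ F = (-h²)ⁿ ∫ χₙ F` with rapidly decreasing `∫ χₙ F`. -/
theorem exists_timeAverage_eq_pow_mul {α : ℝ} (hF : LocallyIntegrable F)
    (hneg : ∀ᵐ t, t < 0 → F t = 0)
    (heq : ∀ χ : ℝ → ℝ, ContDiff ℝ ∞ χ → HasCompactSupport χ → ∀ᵐ ξ,
      timeAverage F (deriv (deriv χ)) ξ = -(angFreq α ξ : ℂ) ^ 2 * timeAverage F χ ξ)
    {χ : ℝ → ℝ} (h1 : ContDiff ℝ ∞ χ) (h2 : HasCompactSupport χ) :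
    ∃ T C : ℝ, ∀ n : ℕ, ∃ b : Lp ℂ 2 (volume : Measure ℝ),
      (∀ᵐ ξ, timeAverage F χ ξ = (-(angFreq α ξ : ℂ) ^ 2) ^ n * b ξ) ∧
      ‖b‖ ≤ C * (T ^ (2 * n) / (2 * n).factorial) := by
  obtain ⟨M, hM⟩ := h1.continuous.bounded_above_of_compact_support h2
  obtain ⟨R, hR⟩ := h2.isCompact.isBounded.subset_closedBall 0
  set T := |R| + 1
  have hM0 : 0 ≤ M := (norm_nonneg _).trans (hM 0)
  have hT : ∀ t, T ≤ t → χ t = 0 := fun t ht => by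
    refine image_eq_zero_of_notMem_tsupport fun h => ?_
    have h3 := hR h
    rw [mem_closedBall_zero_iff, Real.norm_eq_abs] at h3
    have h4 := le_abs_self t
    have h5 := le_abs_self R
    have h6 : |R| + 1 ≤ t := ht
    linarith
  -- The estimate for `χn` is needed on `[0, T]` only, as `F` vanishes for negative times.
  have key : ∀ n : ℕ, ∃ χn : ℝ → ℝ, ContDiff ℝ ∞ χn ∧ HasCompactSupport χn ∧
      (∀ t, T ≤ t → χn t = 0) ∧
      (∀ t ∈ Set.Icc 0 T, |χn t| ≤ M * ((T - t) ^ (2 * n) / (2 * n).factorial)) ∧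
      ∀ᵐ ξ, timeAverage F χ ξ = (-(angFreq α ξ : ℂ) ^ 2) ^ n * timeAverage F χn ξ := by
    intro n
    induction n with
    | zero =>
      refine ⟨χ, h1, h2, hT, fun t _ => ?_, Filter.Eventually.of_forall fun ξ => by simp⟩
      simpa using hM t
    | succ n ih =>
      obtain ⟨χn, hs, -, hTn, hMn, hn⟩ := ih
      obtain ⟨χ', hs', hc', hT', hM', hd'⟩ := exists_deriv_deriv_eq hs hTn hMn
      refine ⟨χ', hs', hc', hT', hM', ?_⟩
      have h3 := timeAverage_congr hneg hd'
      filter_upwards [hn, heq χ' hs' hc'] with ξ h4 h5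
      rw [h4, ← h3, h5, pow_succ]
      ring
  refine ⟨T, M * ∫ t in Set.Icc 0 T, ‖F t‖, fun n => ?_⟩
  obtain ⟨χn, hs, hc, hTn, hMn, hn⟩ := key n
  refine ⟨timeAverage F χn, hn, ?_⟩
  refine (norm_timeAverage_le hF hneg hTn (B := M * (T ^ (2 * n) / (2 * n).factorial))
    fun t ht => (hMn t ht).trans ?_).trans (le_of_eq (by ring))
  have h3 : T - t ≤ T := by linarith [ht.1]
  have h4 : 0 ≤ T - t := by linarith [ht.2]
  gcongr

/-- Factorial decay beats the powers of the (possibly unbounded) symbol on each bounded frequency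
region. -/
theorem eq_zero_of_eq_pow_mul {α T C : ℝ} {a : Lp ℂ 2 (volume : Measure ℝ)}
    (h : ∀ n : ℕ, ∃ b : Lp ℂ 2 (volume : Measure ℝ),
      (∀ᵐ ξ, a ξ = (-(angFreq α ξ : ℂ) ^ 2) ^ n * b ξ) ∧
      ‖b‖ ≤ C * (T ^ (2 * n) / (2 * n).factorial)) : a = 0 := by
  have hm := measurable_angFreq α
  have hR : ∀ R : ℕ, ∀ᵐ ξ, angFreq α ξ ≤ R → a ξ = 0 := fun R => by
    set S : Set ℝ := {ξ | angFreq α ξ ≤ R}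
    have hS : MeasurableSet S := measurableSet_le hm measurable_const
    have hint : ∀ c : Lp ℂ 2 (volume : Measure ℝ), Integrable fun ξ => ‖c ξ‖ ^ 2 := fun c =>
      (Lp.memLp c).integrable_norm_pow (by norm_num)
    have hle : ∀ n : ℕ, ∫ ξ in S, ‖a ξ‖ ^ 2
        ≤ (C * (((R : ℝ) * T) ^ (2 * n) / (2 * n).factorial)) ^ 2 := fun n => by
      obtain ⟨b, hb, hbn⟩ := h n
      calc ∫ ξ in S, ‖a ξ‖ ^ 2 ≤ ∫ ξ in S, ((R : ℝ) ^ (2 * n)) ^ 2 * ‖b ξ‖ ^ 2 := by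
            refine setIntegral_mono_ae_restrict (hint a).integrableOn
              ((hint b).const_mul _).integrableOn ?_
            filter_upwards [ae_restrict_of_ae hb, ae_restrict_mem hS] with ξ h1 h2
            rw [h1, norm_mul, mul_pow, norm_pow, norm_neg, norm_pow, Complex.norm_real,
              Real.norm_of_nonneg (angFreq_nonneg α ξ), ← pow_mul (angFreq α ξ)]
            have h3 := angFreq_nonneg α ξ
            have h4 : angFreq α ξ ≤ R := h2
            gcongr
        _ ≤ ∫ ξ, ((R : ℝ) ^ (2 * n)) ^ 2 * ‖b ξ‖ ^ 2 :=
            setIntegral_le_integral ((hint b).const_mul _)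
              (Filter.Eventually.of_forall fun ξ => by positivity)
        _ = ((R : ℝ) ^ (2 * n) * ‖b‖) ^ 2 := by
            rw [integral_const_mul, ← norm_sq_eq_integral, mul_pow]
        _ ≤ ((R : ℝ) ^ (2 * n) * (C * (T ^ (2 * n) / (2 * n).factorial))) ^ 2 := by gcongr
        _ = _ := by rw [mul_pow (R : ℝ) T]; ring
    have hlim : Filter.Tendsto
        (fun n : ℕ => (C * (((R : ℝ) * T) ^ (2 * n) / (2 * n).factorial)) ^ 2)
        Filter.atTop (nhds 0) := by
      have h1 := (FloorSemiring.tendsto_pow_div_factorial_atTop ((R : ℝ) * T)).comp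
        (Filter.tendsto_id.const_mul_atTop' (r := 2) two_pos)
      simpa using ((h1.const_mul C).pow 2)
    have h0 : ∫ ξ in S, ‖a ξ‖ ^ 2 = 0 :=
      le_antisymm (ge_of_tendsto' hlim hle) (integral_nonneg fun ξ => by positivity)
    rw [setIntegral_eq_zero_iff_of_nonneg_ae (Filter.Eventually.of_forall fun ξ => by positivity)
      (hint a).integrableOn] at h0
    filter_upwards [(ae_restrict_iff' hS).1 h0] with ξ h1 h2
    simpa using h1 h2
  rw [Lp.eq_zero_iff_ae_eq_zero]
  filter_upwards [ae_all_iff.2 hR] with ξ hξ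
  -- The sets `{h_α ≤ R}` with `R ∈ ℕ` exhaust the line.
  obtain ⟨n, hn⟩ := exists_nat_ge (angFreq α ξ)
  exact hξ n hn

/-- Uniqueness for the homogeneous equation `∂_t² d = e`, where `e` is `L^α_x ∂_x²` applied to `d`,
among distributions that vanish for `t < 0`. -/
theorem eq_zero_of_equation {α : ℝ} (hα : α ∈ Set.Ioo (1 : ℝ) 3) {s : ℝ}
    (hF : LocallyIntegrable F) {d e : 𝓢'(ℝ × ℝ, ℂ)} {D W : ℝ → 𝓢'(ℝ, ℂ)} (hd : IsGivenBy d D)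
    (he : IsGivenBy e W) (hD : ∀ t, IsFunction (𝓕 (D t)) fun ξ => besselWeight (-s) ξ * F t ξ)
    (hW : ∀ t, IsFunction (𝓕 (W t)) fun ξ =>
      -(angFreq α ξ : ℂ) ^ 2 * (besselWeight (-s) ξ * F t ξ))
    (heq : ∂_{((0, 1) : ℝ × ℝ)} (∂_{((0, 1) : ℝ × ℝ)} d) = e)
    (hsupp : ∀ Φ : 𝓢(ℝ × ℝ, ℂ), HasCompactSupport Φ → tsupport Φ ⊆ {p | p.2 < 0} → d Φ = 0) :
    d = 0 := by
  have hneg := ae_eq_zero_of_neg hF hd hD hsupp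
  -- A locally integrable function with vanishing averages is zero.
  have hF0 : ∀ᵐ t, F t = 0 := by
    refine ae_eq_zero_of_integral_contDiff_smul_eq_zero hF fun χ h1 h2 => ?_
    obtain ⟨T, C, h⟩ := exists_timeAverage_eq_pow_mul hF hneg
      (fun χ h1 h2 => timeAverage_deriv_deriv hα hF hd he hD hW heq h1 h2) h1 h2
    exact eq_zero_of_eq_pow_mul h
  refine eq_of_eq_on_hasCompactSupport fun Φ hΦ => ?_
  rw [(hd Φ hΦ).2]
  refine integral_eq_zero_of_ae ?_
  filter_upwards [hF0] with t ht
  have h1 : IsFunction (𝓕 (D t)) 0 := (hD t).congr (by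
    rw [ht]
    filter_upwards [Lp.coeFn_zero ℂ 2 (volume : Measure ℝ)] with ξ hξ
    rw [hξ]
    simp)
  have h2 := (h1 (𝓕⁻ (slice t Φ))).2
  rw [TemperedDistribution.fourier_apply, fourier_fourierInv_eq] at h2
  simpa using h2

theorem IsGivenBy.sub {u u' : 𝓢'(ℝ × ℝ, ℂ)} {U U' : ℝ → 𝓢'(ℝ, ℂ)} (h : IsGivenBy u U)
    (h' : IsGivenBy u' U') : IsGivenBy (u - u') fun t => U t - U' t := fun Φ hΦ => by
  obtain ⟨h1, h2⟩ := h Φ hΦ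
  obtain ⟨h1', h2'⟩ := h' Φ hΦ
  refine ⟨h1.sub h1', ?_⟩
  change u Φ - u' Φ = ∫ t, (U t (slice t Φ) - U' t (slice t Φ))
  rw [integral_sub h1 h1', h2, h2']

/-- The Cauchy problem has at most one solution. -/
theorem IsSolution.eq {α : ℝ} (hα : α ∈ Set.Ioo (1 : ℝ) 3) {s : ℝ} {u₀ v₀ : 𝓢'(ℝ, ℂ)}
    {u u' : 𝓢'(ℝ × ℝ, ℂ)} (h : IsSolution α s u₀ v₀ u) (h' : IsSolution α s u₀ v₀ u') :
    u = u' := by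
  obtain ⟨⟨U, W, w, ⟨G, hG, hGi⟩, hU, hL, hw, heq⟩, hsupp⟩ := h
  obtain ⟨⟨U', W', w', ⟨G', hG', hGi'⟩, hU', hL', hw', heq'⟩, hsupp'⟩ := h'
  have hB : ∀ t, besselPotential ℝ ℂ s (U t - U' t)
      = ((G t - G' t : Lp ℂ 2 (volume : Measure ℝ)) : 𝓢'(ℝ, ℂ)) := fun t => by
    rw [map_sub, hG, hG', ← Lp.toTemperedDistributionCLM_apply, ← Lp.toTemperedDistributionCLM_apply,
      ← Lp.toTemperedDistributionCLM_apply, map_sub]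
  have hD := fun t => (besselPotential_eq_iff s _ _).1 (hB t)
  have hF : LocallyIntegrable fun t => (𝓕 (G t - G' t) : Lp ℂ 2 (volume : Measure ℝ)) :=
    fun x => by
      obtain ⟨S, hS, hi⟩ := (hGi.sub hGi') x
      exact ⟨S, hS, (fourierCLM ℂ (Lp ℂ 2 (volume : Measure ℝ))).integrable_comp hi⟩
  have hW : ∀ t, IsFunction (𝓕 (W t - W' t)) fun ξ => -(angFreq α ξ : ℂ) ^ 2
      * (besselWeight (-s) ξ * (𝓕 (G t - G' t) : Lp ℂ 2 (volume : Measure ℝ)) ξ) := fun t => by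
    have h1 := (hL t).isFunction_fourier hα ((besselPotential_eq_iff s _ _).1 (hG t))
    have h2 := (hL' t).isFunction_fourier hα ((besselPotential_eq_iff s _ _).1 (hG' t))
    have h3 : 𝓕 (W t - W' t) = 𝓕 (W t) - 𝓕 (W' t) := (fourierCLM ℂ 𝓢'(ℝ, ℂ)).map_sub _ _
    have h4 : (𝓕 (G t - G' t) : Lp ℂ 2 (volume : Measure ℝ)) = 𝓕 (G t) - 𝓕 (G' t) :=
      (fourierCLM ℂ (Lp ℂ 2 (volume : Measure ℝ))).map_sub _ _
    rw [h3, h4]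
    refine (h1.sub h2).congr ?_
    filter_upwards [Lp.coeFn_sub (𝓕 (G t) : Lp ℂ 2 (volume : Measure ℝ)) (𝓕 (G' t))] with ξ hξ
    rw [hξ, Pi.sub_apply]
    ring
  refine sub_eq_zero.1 (eq_zero_of_equation hα hF (hU.sub hU') (hw.sub hw') hD hW ?_ ?_)
  · have h1 : ∂_{((0, 1) : ℝ × ℝ)} (∂_{((0, 1) : ℝ × ℝ)} (u - u'))
        = ∂_{((0, 1) : ℝ × ℝ)} (∂_{((0, 1) : ℝ × ℝ)} u)
          - ∂_{((0, 1) : ℝ × ℝ)} (∂_{((0, 1) : ℝ × ℝ)} u') := by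
      have h2 := (LineDeriv.lineDerivOpCLM ℂ 𝓢'(ℝ × ℝ, ℂ) ((0, 1) : ℝ × ℝ)).map_sub
      simp only [LineDeriv.lineDerivOpCLM_apply] at h2
      rw [h2, h2]
    rw [h1]
    have h2 := heq.trans heq'.symm
    rw [sub_eq_sub_iff_add_eq_add] at h2 ⊢
    exact h2.trans (add_comm _ _)
  · intro Φ hΦ hs
    have hc : ∀ {v : 𝓢'(ℝ × ℝ, ℂ)}, Distribution.dsupport v ⊆ {p : ℝ × ℝ | 0 ≤ p.2} → v Φ = 0 :=
      fun {v} hv => apply_eq_zero_of_tsupport_subset_compl_dsupport hΦ fun p hp hp' =>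
        not_lt.2 (show (0 : ℝ) ≤ p.2 from hv hp') (show p.2 < 0 from hs hp)
    change u Φ - u' Φ = 0
    rw [hc hsupp, hc hsupp', sub_zero]

end Uniqueness

/-! ### The generalized Cauchy problem -/

theorem isFunction_fourier_E₀ (α t : ℝ) : IsFunction (𝓕 (E₀ α t)) fun ξ =>
    ((Real.cos (angFreq α ξ * t) * heaviside t : ℝ) : ℂ) := by
  rw [E₀, fourier_fourierInv_eq]
  exact isFunction_ofBounded (memLp_symbolE₀ α t)

theorem isFunction_fourier_E₁ (α t : ℝ) : IsFunction (𝓕 (E₁ α t)) fun ξ =>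
    ((Real.sin (angFreq α ξ * t) / angFreq α ξ * heaviside t : ℝ) : ℂ) := by
  rw [E₁, fourier_fourierInv_eq]
  exact isFunction_ofBounded (memLp_symbolE₁ α t)

end FractionalEringen

open FractionalEringen in
theorem mainTheorem1 (α : ℝ) (hα : α ∈ Set.Ioo (1 : ℝ) 3) (s : ℝ) (u₀ v₀ : 𝓢'(ℝ, ℂ))
    (hu₀ : MemSobolev s 2 u₀) (hv₀ : MemSobolev (s - 1 + α / 2) 2 v₀) :
    ∃ u : 𝓢'(ℝ × ℝ, ℂ),
      FractionalEringen.IsSolution α s u₀ v₀ u ∧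
      (∀ u' : 𝓢'(ℝ × ℝ, ℂ), FractionalEringen.IsSolution α s u₀ v₀ u' → u' = u) ∧
      ∃ U : ℝ → 𝓢'(ℝ, ℂ),
        FractionalEringen.IsL1Loc s U ∧
        FractionalEringen.IsGivenBy u U ∧
        FractionalEringen.IsSmoothTempered U ∧
        FractionalEringen.IsContinuousSobolev s U ∧
        ∀ t : ℝ, ∃ A B : 𝓢'(ℝ, ℂ),
          FractionalEringen.IsConvolution u₀ (FractionalEringen.E₀ α t) A ∧
          FractionalEringen.IsConvolution v₀ (FractionalEringen.E₁ α t) B ∧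
          U t = A + B := by
  obtain ⟨a, ha⟩ := exists_isFunction_fourier_of_memSobolev hu₀
  obtain ⟨b, hb⟩ := exists_isFunction_fourier_of_memSobolev hv₀
  have h₀ := isTempered_besselWeight_mul (-s) a
  have h₁ := isTempered_besselWeight_mul (-(s - 1 + α / 2)) b
  obtain ⟨F, hF, hFU⟩ := exists_waveState_eq hα s a b
  set g₀ : ℝ → ℂ := fun ξ => besselWeight (-s) ξ * a ξ
  set g₁ : ℝ → ℂ := fun ξ => besselWeight (-(s - 1 + α / 2)) ξ * b ξ
  have hL1 : IsL1Loc s (waveState α g₀ g₁) :=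
    ⟨_, hFU, hF.locallyIntegrable.indicator measurableSet_Ici⟩
  have hsol : IsSolution α s u₀ v₀ (waveDistribution hα h₀ h₁) :=
    ⟨⟨_, _, _, hL1, isGivenBy_waveDistribution hα h₀ h₁, isLapEringen_waveState hα h₀ h₁,
      isGivenBy_waveDistribution hα (h₀.lapMul hα) (h₁.lapMul hα),
      waveDistribution_equation hα h₀ h₁ ha hb⟩, dsupport_waveDistribution_subset hα h₀ h₁⟩
  refine ⟨_, hsol, fun u' hu' => hu'.eq hα hsol, _, hL1, isGivenBy_waveDistribution hα h₀ h₁,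
    isSmoothTempered_waveState hα h₀ h₁, ⟨F, fun t ht => ?_, hF.continuousOn⟩, fun t => ?_⟩
  · rw [hFU t, Set.indicator_of_mem (Set.mem_Ici.2 (le_of_lt ht))]
  -- The convolutions with `E₀(t)`, `E₁(t)` are the waves with one of the two data set to zero.
  · have hz : IsTempered 0 := ⟨aestronglyMeasurable_const, 0, by simp⟩
    have hA := isFunction_fourier_waveState α h₀ hz t
    have hB := isFunction_fourier_waveState α hz h₁ t
    refine ⟨waveState α g₀ 0 t, waveState α 0 g₁ t,
      ⟨_, _, ha, isFunction_fourier_E₀ α t, hA.congr (Filter.Eventually.of_forall fun ξ => ?_)⟩,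
      ⟨_, _, hb, isFunction_fourier_E₁ α t, hB.congr (Filter.Eventually.of_forall fun ξ => ?_)⟩, ?_⟩
    · simp only [wave, Pi.zero_apply]
      push_cast
      ring
    · simp only [wave, Pi.zero_apply]
      push_cast
      ring
    · have h3 := isFunction_fourier_waveState α h₀ h₁ t
      have h4 : 𝓕 (waveState α g₀ g₁ t) = 𝓕 (waveState α g₀ 0 t + waveState α 0 g₁ t) := by
        have h5 : 𝓕 (waveState α g₀ 0 t + waveState α 0 g₁ t)
            = 𝓕 (waveState α g₀ 0 t) + 𝓕 (waveState α 0 g₁ t) :=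
          (fourierCLM ℂ 𝓢'(ℝ, ℂ)).map_add _ _
        rw [h5]
        refine h3.eq ((hA.add hB).congr (Filter.Eventually.of_forall fun ξ => ?_))
        simp only [wave, Pi.zero_apply]
        ring
      have h6 := congrArg (fun T : 𝓢'(ℝ, ℂ) => (𝓕⁻ T : 𝓢'(ℝ, ℂ))) h4
      simpa only [fourierInv_fourier_eq] using h6
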